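/- Let $R$ be a discrete valuation domain with maximal ideal $M$, finite residue field, valuation $v$ and quotient field $K$, and let $\mathrm{Int}(R)=\{F\in K[x] : F(R)\subseteq R\}$. An irreducible element $d$ of a domain is absolutely irreducible if, for all $n\ge 1$, $d^n$ factors into irreducibles uniquely (up to order and units). The fixed divisor of $F\in\mathrm{Int}(R)$ is the ideal of $R$ generated by the values $F(a)$, $a\in R$; $F$ is image-primitive if this ideal is $R$. A finite set $S\subseteq R$ is balanced if the neighborhoods $s+M^{n_s}$ $(s\in S)$ cover $R$, where $n_s\ge 0$ is minimal such that $s+M^{n_s}$ contains no element of $S$ other than $s$ (such a set is automatically nonempty). For a finite set $\emptyset\neq S\subseteq R$, the partition associated to $S$ is the unique partition of $R$ of the form $\{s+M^{\rho_S(s)} : s\in S\}$ such that each block $s+M^{\rho_S(s)}$ contains both a residue class of $M^{\rho_S(s)+1}$ that meets $S$ and one that is disjoint from $S$. For balanced $S$, let $A=(a_{s,t})_{s,t\in S}$ with $a_{s,s}=\rho_S(s)$ and $a_{s,t}=v(s-t)$ for $s\ne t$; an equalizing polynomial of $S$ is a polynomial $f=\prod_{s\in S}(x-s)^{m_s}$,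 where the $m_s$ are positive integers with $\gcd(m_s : s\in S)=1$ and $A\,(m_s)_{s\in S}=e\,(1,\dots,1)^T$ for some integer $e\ge 0$. Every balanced finite set $S\subseteq R$ has exactly one equalizing polynomial. Identify polynomials in $\mathrm{Int}(R)$ that differ only by multiplication by a unit of $R$. Then the absolutely irreducible elements of $\mathrm{Int}(R)$ of the form $$c^{-1}\prod_{s\in S}(x-s)^{m_s}$$ with $\emptyset\ne S\subseteq R$ finite, each $m_s$ a positive integer, and $c\in K\setminus\{0\}$, correspond bijectively to the balanced finite sets $S\subseteq R$. The bijection maps $F$ to its set of roots. Its inverse maps a balanced set $S$ to $c_f^{-1}f$, where $f$ is the equalizing polynomial of $S$ and $c_f\in R$ is any generator of the fixed divisor of $f$ (which is a principal ideal); this is, up to units of $R$, the unique image-primitive polynomial in $\mathrm{Int}(R)$ associated in $K[x]$ to $f$. -/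

import Mathlib

open Polynomial

namespace IntPoly

section Factorization

variable {D : Type*} [CommRing D]

/-- An irreducible element `d` is absolutely irreducible if every power `d ^ n`, `n ≥ 1`, has an
essentially unique factorization: any two multisets of irreducible elements with product `d ^ n`
agree up to order and associates. -/
def IsAbsolutelyIrreducible (d : D) : Prop :=
  Irreducible d ∧ ∀ n : ℕ, 1 ≤ n → ∀ l₁ l₂ : Multiset D,
    (∀ a ∈ l₁, Irreducible a) → (∀ a ∈ l₂, Irreducible a) →
      l₁.prod = d ^ n → l₂.prod = d ^ n → Multiset.Rel Associated l₁ l₂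

end Factorization

section IntegerValued

variable (R K : Type*) [CommRing R] [Field K] [Algebra R K]

/-- The ring `Int(R) = {F ∈ K[x] | F(R) ⊆ R}` of integer-valued polynomials on `R`. -/
def intValued : Subalgebra R K[X] where
  carrier := {F | ∀ a : R, F.eval (algebraMap R K a) ∈ (algebraMap R K).range}
  mul_mem' := by
    intro F G hF hG a
    rw [eval_mul]
    exact mul_mem (hF a) (hG a)
  add_mem' := by
    intro F G hF hG a
    rw [eval_add]
    exact add_mem (hF a) (hG a)
  algebraMap_mem' := by
    intro r a
    exact ⟨r, by rw [Polynomial.algebraMap_apply, eval_C]⟩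

variable {R K}

/-- The fixed divisor of `F ∈ Int(R)`: the ideal of `R` generated by the values `F(a)`, `a ∈ R`. -/
def fixedDivisor (F : intValued R K) : Ideal R :=
  Ideal.span {b : R | ∃ a : R, algebraMap R K b = (F : K[X]).eval (algebraMap R K a)}

/-- `F ∈ Int(R)` is image-primitive if its fixed divisor is all of `R`. -/
def IsImagePrimitive (F : intValued R K) : Prop :=
  fixedDivisor F = ⊤

variable (R K)

/-- The absolutely irreducible elements of `Int(R)` of the form `c⁻¹ ∏_{s ∈ S} (x - s)^{m_s}` with
`∅ ≠ S ⊆ R` finite, all `m_s` positive, and `c ∈ K \ {0}`. -/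
def splitAbsIrred : Set (intValued R K) :=
  {F | IsAbsolutelyIrreducible F ∧
    ∃ S : Finset R, S.Nonempty ∧ ∃ m : R → ℕ, (∀ s ∈ S, 0 < m s) ∧ ∃ c : K, c ≠ 0 ∧
      (F : K[X]) = C c⁻¹ * ∏ s ∈ S, (X - C (algebraMap R K s)) ^ m s}

/-- Identification of polynomials that differ only by multiplication by a unit of `R`. -/
def unitSetoid : Setoid (splitAbsIrred R K) where
  r F G := ∃ u : Rˣ, ((G : intValued R K) : K[X]) =
    C (algebraMap R K u) * ((F : intValued R K) : K[X])
  iseqv :=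
    { refl := fun F => ⟨1, by simp⟩
      symm := by
        rintro F G ⟨u, hu⟩
        refine ⟨u⁻¹, ?_⟩
        rw [hu, ← mul_assoc, ← C_mul, ← map_mul, Units.inv_mul, map_one, C_1, one_mul]
      trans := by
        rintro F G H ⟨u, hu⟩ ⟨w, hw⟩
        refine ⟨w * u, ?_⟩
        rw [hw, hu, Units.val_mul, map_mul, C_mul, mul_assoc] }

end IntegerValued

section Balanced

variable {R : Type*} [CommRing R] [IsDomain R] [IsDiscreteValuationRing R]

/-- The basic neighborhood (residue class) `s + M ^ n`, `M` being the maximal ideal of `R`. -/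
def nbhd (s : R) (n : ℕ) : Set R :=
  {r | r - s ∈ IsLocalRing.maximalIdeal R ^ n}

/-- The minimal `n` such that `s + M ^ n` contains no element of `S` other than `s`
(such `n` exist because `S` is finite and the powers of `M` intersect in `0`). -/
noncomputable def isolationIndex (S : Finset R) (s : R) : ℕ :=
  sInf {n : ℕ | ∀ t ∈ S, t ≠ s → t ∉ nbhd s n}

/-- A finite set `S ⊆ R` is balanced if the neighborhoods `s + M ^ (n_s)`, with `n_s` minimal such
that `s + M ^ (n_s)` contains no other element of `S`, cover `R`. -/
def IsBalanced (S : Finset R) : Prop :=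
  ⋃ s ∈ S, nbhd s (isolationIndex S s) = Set.univ

/-- The partition associated to a finite set `S`: a partition of `R` of the form
`{s + M ^ (n_s) | s ∈ S}` (repetitions allowed) each of whose blocks `s + M ^ (n_s)` contains both
a residue class of `M ^ (n_s + 1)` that meets `S` and one that is disjoint from `S`. There is
exactly one such partition if `S` is nonempty and the residue field is finite. -/
def IsAssociatedPartition (S : Finset R) (P : Set (Set R)) : Prop :=
  Setoid.IsPartition P ∧ ∃ n : R → ℕ, P = {B | ∃ s ∈ S, B = nbhd s (n s)} ∧
    ∀ s ∈ S,
      (∃ r : R, nbhd r (n s + 1) ⊆ nbhd s (n s) ∧ (nbhd r (n s + 1) ∩ S).Nonempty) ∧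
      (∃ r : R, nbhd r (n s + 1) ⊆ nbhd s (n s) ∧ Disjoint (nbhd r (n s + 1)) (S : Set R))

open Classical in
/-- The partition matrix: `ρ s` on the diagonal and the valuation `v(s - t)` off the diagonal,
where `s + M ^ (ρ s)` is the block of `s`. -/
noncomputable def partitionMatrix (S : Finset R) (ρ : S → ℕ) : Matrix S S ℕ :=
  Matrix.of fun s t =>
    if s = t then ρ s else (IsDiscreteValuationRing.addVal R ((s : R) - (t : R))).toNat

/-- `f` is an equalizing polynomial of the (balanced) set `S`: `f = ∏_{s ∈ S} (x - s)^{m_s}` where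
`m` is a vector of positive integers with greatest common divisor `1` and `A m = e (1, …, 1)` for
some `e ∈ ℕ`, with `A` the partition matrix of the partition associated to `S`. -/
def IsEqualizingPolynomial {K : Type*} [Field K] [Algebra R K] (S : Finset R)
    (f : intValued R K) : Prop :=
  ∃ (P : Set (Set R)) (ρ : S → ℕ), IsAssociatedPartition S P ∧ (∀ s : S, nbhd (s : R) (ρ s) ∈ P) ∧
    ∃ (m : S → ℕ) (e : ℕ), (∀ s, 0 < m s) ∧ Finset.univ.gcd m = 1 ∧
      (partitionMatrix S ρ).mulVec m = (fun _ => e) ∧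
      (f : K[X]) = ∏ s : S, (X - C (algebraMap R K (s : R))) ^ m s

end Balanced

end IntPoly

/-! Fix `S`. A polynomial with leading coefficient `c`, roots in `S` and exponents `g` is
integer-valued exactly when `v(c) + ∑ g_s v(r - s) ≥ 0` for all `r ∉ S`
(`splitPoly_mem_intValued_iff`). Divisors of such polynomials have the same shape, so factoring
powers of `F` becomes a question about exponent vectors and minima of `valAt`. Let `A` be `isoMatrix
S`. Each row of `A` is the valuation vector `(v(r - s))_s` of some `r ∉ S`; if `S` is balanced,
every such vector dominates a row of `A`, so these minima can be read off `A`.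

From a balanced set to a polynomial: `A` is strictly ultrametric, so
(`exists_pos_solution_of_ultrametric`) there is exactly one positive coprime `m` with `A m = e (1,
…, 1)`, and all natural solutions with constant image are multiples of it. If `J H = F ^ N`, where
`F` has exponents `m` and `v(c) = -e`, integrality bounds the rows for `J` and `H` from below, and
these bounds add up to the exact total `N e`. Hence equality holds, the rows for `J` are constant,
and `J` is associated to a power of `F`; absolute irreducibility follows by comparing degrees.

From a polynomial to a balanced set: an irreducible `F` is image-primitive, since otherwise a
uniformizer splits off. Absolute irreducibility then becomes `IsExtremal`: compatible decompositions
of `N m` consist of multiples of `m`. Perturbing `N m` by `±δ` shows that the valuation vectors of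
the minimizers of `valAt`, with all entries raised by one, have no common nonzero orthogonal vector
(`IsExtremal.eq_zero`). The vector of a minimizer depends only on a point of `S` closest to it, so
each `s ∈ S` must be the unique closest point of some minimizer; otherwise there would be fewer than
`|S|` vectors. This forces `A m` to be constant, and minimality forces the neighborhoods to cover
`R`. -/

namespace IntPoly

/-! ### Linear systems with strictly ultrametric matrices -/

/-- A system of linear equations given by a strictly ultrametric matrix and a constant right-hand
side has exactly one solution, and it is a multiple of a positive vector. -/
theorem exists_pos_solution_of_ultrametric {α : Type*} [DecidableEq α] (S : Finset α) (hS : S.Nonempty)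
    (a : α → α → ℚ) (hsymm : ∀ s ∈ S, ∀ t ∈ S, a s t = a t s)
    (hultra : ∀ s ∈ S, ∀ t ∈ S, ∀ u ∈ S, min (a s u) (a u t) ≤ a s t)
    (hnonneg : ∀ s ∈ S, ∀ t ∈ S, 0 ≤ a s t)
    (hpos : ∀ s ∈ S, 0 < a s s) (hdiag : ∀ s ∈ S, ∀ t ∈ S, t ≠ s → a s t < a s s) :
    ∃ m : α → ℚ, (∀ s ∈ S, 0 < m s) ∧ (∀ s ∈ S, ∑ t ∈ S, a s t * m t = 1) ∧
      ∀ (x : α → ℚ) (c : ℚ), (∀ s ∈ S, ∑ t ∈ S, a s t * x t = c) → ∀ s ∈ S, x s = c * m s := by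
  induction hn : S.card using Nat.strong_induction_on generalizing S a with
  | _ n ih =>
  subst hn
  by_cases hoff : S.offDiag.Nonempty
  · obtain ⟨⟨s₀, t₀⟩, hst₀, hmin⟩ := S.offDiag.exists_min_image (fun p => a p.1 p.2) hoff
    rw [Finset.mem_offDiag] at hst₀
    obtain ⟨hs₀, ht₀, hne₀⟩ := hst₀
    dsimp only at hs₀ ht₀ hne₀
    set k := a s₀ t₀ with hk
    have hk0 : 0 ≤ k := hnonneg _ hs₀ _ ht₀
    have hmin' : ∀ s ∈ S, ∀ t ∈ S, k ≤ a s t := by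
      intro s hs t ht
      have off : ∀ s ∈ S, ∀ t ∈ S, s ≠ t → k ≤ a s t := fun s hs t ht h =>
        hmin (s, t) (Finset.mem_offDiag.2 ⟨hs, ht, h⟩)
      by_cases h : s = t
      · subst h
        by_cases h' : s = s₀
        · subst h'; exact (hdiag _ hs _ ht₀ hne₀.symm).le
        · exact (off s hs s₀ hs₀ h').trans (hdiag _ hs _ hs₀ (Ne.symm h')).le
      · exact off s hs t ht h
    have hkdiag : ∀ s ∈ S, k < a s s := by
      intro s hs
      by_cases h' : s = s₀
      · subst h'; exact hdiag _ hs _ ht₀ hne₀.symm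
      · exact (hmin' s hs s₀ hs₀).trans_lt (hdiag _ hs _ hs₀ (Ne.symm h'))
    -- By the ultrametric inequality, `k < a s t` is an equivalence relation on `S`. Subtracting the
    -- least off-diagonal entry `k` makes the matrix block diagonal along its classes, all proper
    -- because `s₀` and `t₀` are separated.
    let cl : α → Finset α := fun s => S.filter fun t => k < a s t
    have mem_cl : ∀ s t, t ∈ cl s ↔ t ∈ S ∧ k < a s t := fun s t => Finset.mem_filter
    have cl_eq : ∀ s ∈ S, ∀ t ∈ cl s, cl t = cl s := by
      intro s hs t ht
      obtain ⟨ht, hst⟩ := (mem_cl _ _).1 ht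
      ext u
      rw [mem_cl, mem_cl]
      refine and_congr_right fun hu => ⟨fun h => ?_, fun h => ?_⟩
      · exact (lt_min hst h).trans_le (hultra s hs u hu t ht)
      · exact (lt_min (by rwa [hsymm t ht s hs]) h).trans_le (hultra t ht u hu s hs)
    have cl_lt : ∀ s ∈ S, (cl s).card < S.card := by
      intro s hs
      refine Finset.card_lt_card (Finset.ssubset_iff_subset_ne.2 ⟨Finset.filter_subset _ _, ?_⟩)
      intro h
      have h1 : s₀ ∈ cl s := h ▸ hs₀
      have h2 : t₀ ∈ cl s := h ▸ ht₀
      rw [mem_cl] at h1 h2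
      have := hultra s₀ hs₀ t₀ ht₀ s hs
      rw [hsymm s₀ hs₀ s hs] at this
      exact absurd ((lt_min h1.2 h2.2).trans_le this) (lt_irrefl _)
    -- The solution is chosen for the class as a set, not for a representative, so that the values
    -- glued into `μ` agree with a single block solution on each class.
    have step : ∀ C : Finset α, ∃ m : α → ℚ, (∃ s ∈ S, C = cl s) →
        (∀ s ∈ C, 0 < m s) ∧ (∀ s ∈ C, ∑ t ∈ C, (a s t - k) * m t = 1) ∧
        ∀ (x : α → ℚ) (c : ℚ), (∀ s ∈ C, ∑ t ∈ C, (a s t - k) * x t = c) →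
          ∀ s ∈ C, x s = c * m s := by
      intro C
      by_cases hC : ∃ s ∈ S, C = cl s
      · obtain ⟨s, hs, rfl⟩ := hC
        have sub : ∀ t ∈ cl s, t ∈ S := fun t ht => ((mem_cl _ _).1 ht).1
        obtain ⟨m, hm⟩ := ih _ (cl_lt s hs) (cl s) ⟨s, (mem_cl _ _).2 ⟨hs, hkdiag s hs⟩⟩
          (fun s t => a s t - k)
          (fun s hs t ht => by rw [hsymm s (sub s hs) t (sub t ht)])
          (fun s hs t ht u hu => by
            rw [min_sub_sub_right]
            exact sub_le_sub_right (hultra s (sub s hs) t (sub t ht) u (sub u hu)) k)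
          (fun s hs t ht => sub_nonneg.2 (hmin' s (sub s hs) t (sub t ht)))
          (fun s hs => sub_pos.2 (hkdiag s (sub s hs)))
          (fun s hs t ht h => sub_lt_sub_right (hdiag s (sub s hs) t (sub t ht) h) k) rfl
        exact ⟨m, fun _ => hm⟩
      · exact ⟨0, fun h => absurd h hC⟩
    choose M hM using step
    have hM' := fun s (hs : s ∈ S) => hM (cl s) ⟨s, hs, rfl⟩
    have self_mem : ∀ s ∈ S, s ∈ cl s := fun s hs => (mem_cl _ _).2 ⟨hs, hkdiag s hs⟩
    let μ : α → ℚ := fun s => M (cl s) s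
    have hμpos : ∀ s ∈ S, 0 < μ s := fun s hs => (hM' s hs).1 s (self_mem s hs)
    have split : ∀ (x : α → ℚ), ∀ s ∈ S, ∑ t ∈ S, a s t * x t =
        ∑ t ∈ cl s, (a s t - k) * x t + k * ∑ t ∈ S, x t := by
      intro x s hs
      have : ∑ t ∈ cl s, (a s t - k) * x t = ∑ t ∈ S, (a s t - k) * x t := by
        refine Finset.sum_subset (Finset.filter_subset _ _) fun t ht h => ?_
        rw [mem_cl, not_and, not_lt] at h
        rw [le_antisymm (h ht) (hmin' s hs t ht), sub_self, zero_mul]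
      rw [this, Finset.mul_sum, ← Finset.sum_add_distrib]
      exact Finset.sum_congr rfl fun t _ => by ring
    have hμ : ∀ s ∈ S, ∑ t ∈ cl s, (a s t - k) * μ t = 1 := by
      intro s hs
      rw [← (hM' s hs).2.1 s (self_mem s hs)]
      refine Finset.sum_congr rfl fun t ht => ?_
      simp only [μ, cl_eq s hs t ht]
    set T := ∑ t ∈ S, μ t with hT
    have hTpos : 0 < T := Finset.sum_pos hμpos hS
    have hden : 0 < 1 + k * T := by positivity
    refine ⟨fun s => μ s / (1 + k * T), fun s hs => div_pos (hμpos s hs) hden, fun s hs => ?_,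
      fun x c hx => ?_⟩
    · have := split μ s hs
      rw [hμ s hs] at this
      simp_rw [← mul_div_assoc]
      rw [← Finset.sum_div, this, div_self hden.ne']
    -- On every block `x` solves the reduced system with the same right-hand side `c'`. Hence `x =
    -- c' μ`, and summing over `S` determines `c'` from `c`.
    · set c' := c - k * ∑ t ∈ S, x t with hc'
      have hx' : ∀ s ∈ S, x s = c' * μ s := by
        intro s hs
        refine (hM' s hs).2.2 x c' (fun t ht => ?_) s (self_mem s hs)
        have htS := ((mem_cl _ _).1 ht).1
        have := split x t htS
        rw [hx t htS, cl_eq s hs t ht] at this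
        linarith
      have hsum : ∑ t ∈ S, x t = c' * T := by
        rw [hT, Finset.mul_sum]
        exact Finset.sum_congr rfl hx'
      rw [hsum] at hc'
      intro s hs
      rw [hx' s hs]
      have : c = c' * (1 + k * T) := by linarith
      rw [this]
      field_simp
  · obtain ⟨s, hs⟩ := hS
    have hS1 : S = {s} := by
      refine Finset.eq_singleton_iff_unique_mem.2 ⟨hs, fun t ht => ?_⟩
      by_contra h
      exact hoff ⟨(t, s), Finset.mem_offDiag.2 ⟨ht, hs, h⟩⟩
    subst hS1
    have h0 := hpos s hs
    refine ⟨fun t => 1 / a s s, fun t _ => one_div_pos.2 h0, fun t ht => ?_, fun x c hx t ht => ?_⟩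
    · rw [Finset.mem_singleton] at ht
      subst ht
      rw [Finset.sum_singleton]
      field_simp
    · rw [Finset.mem_singleton] at ht
      subst ht
      have := hx t hs
      rw [Finset.sum_singleton] at this
      rw [← this]
      field_simp

/-! ### Ultrametric geometry of a discrete valuation ring -/

section Valuation

variable {R : Type*} [CommRing R] [IsDomain R] [IsDiscreteValuationRing R]

/-- The valuation of `r - s` as a natural number (with value `0` if `r = s`). -/
noncomputable def vd (r s : R) : ℕ :=
  (IsDiscreteValuationRing.addVal R (r - s)).toNat

theorem addVal_sub_eq {r s : R} (h : r ≠ s) :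
    IsDiscreteValuationRing.addVal R (r - s) = (vd r s : ℕ∞) := by
  refine (ENat.natCast_toNat ?_).symm
  rw [Ne, IsDiscreteValuationRing.addVal_eq_top_iff]
  exact sub_ne_zero.2 h

theorem vd_self (r : R) : vd r r = 0 := by
  simp [vd]

theorem vd_comm (r s : R) : vd r s = vd s r := by
  rw [vd, vd, AddValuation.map_sub_swap]

/-- Distinctness is needed because `vd r r` is `0` instead of infinity; a coincidence with `t` only
makes the left side `0`. -/
theorem vd_ultra {r s : R} (h : r ≠ s) (t : R) : min (vd r t) (vd t s) ≤ vd r s := by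
  by_cases h1 : r = t
  · subst h1; simp [vd_self]
  by_cases h2 : t = s
  · subst h2; simp [vd_self]
  have := IsDiscreteValuationRing.addVal_add (a := r - t) (b := t - s)
  rw [sub_add_sub_cancel, addVal_sub_eq h, addVal_sub_eq h1, addVal_sub_eq h2,
    min_le_iff] at this
  rw [min_le_iff]
  exact_mod_cast this

/-- Isosceles principle: moving `s` to a point closer to it than `r` is does not change the
valuation of the difference from `r`. -/
theorem vd_eq_of_lt {r s t : R} (h : r ≠ s) (hlt : vd r s < vd s t) : vd r t = vd r s := by
  have hrt : r ≠ t := by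
    rintro rfl
    rw [vd_comm] at hlt
    exact lt_irrefl _ hlt
  have h1 := vd_ultra hrt s
  have h2 := vd_ultra h t
  rw [vd_comm t s] at h2
  rw [min_eq_left hlt.le] at h1
  rcases min_le_iff.1 h2 with h3 | h3
  · exact le_antisymm h3 h1
  · omega

theorem vd_eq_of_gt {r s t : R} (hst : s ≠ t) (hlt : vd s t < vd r s) :
    vd r t = vd s t := by
  rw [vd_comm r t, vd_comm s t]
  refine vd_eq_of_lt hst.symm ?_
  rwa [vd_comm t s, vd_comm s r]

/-- If `s` maximizes `vd r`, then `r` and `s` have the same distance from the farther points. -/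
theorem vd_eq_min {r s t : R} (hrt : r ≠ t) (hst : s ≠ t) (hmax : vd r t ≤ vd r s) :
    vd r t = min (vd r s) (vd s t) := by
  rcases lt_or_ge (vd s t) (vd r s) with h | h
  · rw [vd_eq_of_gt hst h, min_eq_right h.le]
  · rw [min_eq_left h]
    refine le_antisymm hmax ?_
    have := vd_ultra hrt s
    rwa [min_eq_left h] at this

theorem mem_nbhd_iff {s r : R} {n : ℕ} : r ∈ nbhd s n ↔ r = s ∨ n ≤ vd s r := by
  obtain ⟨ϖ, hϖ⟩ := IsDiscreteValuationRing.exists_irreducible R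
  rw [nbhd, Set.mem_ofPred_eq, hϖ.maximalIdeal_eq, Ideal.span_singleton_pow,
    Ideal.mem_span_singleton, ← IsDiscreteValuationRing.addVal_le_iff_dvd, hϖ.addVal_pow]
  by_cases h : r = s
  · simp [h]
  · rw [addVal_sub_eq h, vd_comm]
    simp [h]

theorem self_mem_nbhd (s : R) (n : ℕ) : s ∈ nbhd s n := mem_nbhd_iff.2 (Or.inl rfl)

theorem mem_nbhd_symm {s r : R} {n : ℕ} (h : r ∈ nbhd s n) : s ∈ nbhd r n := by
  rw [mem_nbhd_iff] at h ⊢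
  rwa [eq_comm, vd_comm]

theorem nbhd_subset {s r : R} {m n : ℕ} (h : r ∈ nbhd s m) (hmn : m ≤ n) :
    nbhd r n ⊆ nbhd s m := by
  intro x hx
  have : x - s = (x - r) + (r - s) := by ring
  rw [nbhd, Set.mem_ofPred_eq, this]
  exact Ideal.add_mem _ (Ideal.pow_le_pow_right hmn hx) h

theorem exists_vd_eq (s : R) (n : ℕ) : ∃ r : R, r ≠ s ∧ vd r s = n := by
  obtain ⟨ϖ, hϖ⟩ := IsDiscreteValuationRing.exists_irreducible R
  refine ⟨s + ϖ ^ n, ?_, ?_⟩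
  · simp [hϖ.ne_zero]
  · rw [vd, add_sub_cancel_left, hϖ.addVal_pow, ENat.toNat_natCast]

theorem nbhd_le_of_subset {s : R} {m n : ℕ} (h : nbhd s m ⊆ nbhd s n) : n ≤ m := by
  obtain ⟨r, hr, hv⟩ := exists_vd_eq s m
  have := h (mem_nbhd_iff.2 (Or.inr (by rw [vd_comm, hv])) : r ∈ nbhd s m)
  rw [mem_nbhd_iff, vd_comm, hv] at this
  exact this.resolve_left hr

theorem nbhd_injective (s : R) {m n : ℕ} (h : nbhd s m = nbhd s n) : m = n :=
  (nbhd_le_of_subset h.symm.subset).antisymm (nbhd_le_of_subset h.subset)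

theorem isolationIndex_set_iff (S : Finset R) (s : R) (n : ℕ) :
    (∀ t ∈ S, t ≠ s → t ∉ nbhd s n) ↔ ∀ t ∈ S, t ≠ s → vd s t < n := by
  refine forall₃_congr fun t _ h => ?_
  rw [mem_nbhd_iff]
  simp [h]

theorem vd_lt_isolationIndex {S : Finset R} {s t : R} (ht : t ∈ S) (h : t ≠ s) :
    vd s t < isolationIndex S s := by
  have hne : {n : ℕ | ∀ t ∈ S, t ≠ s → t ∉ nbhd s n}.Nonempty := by
    refine ⟨S.sup (vd s) + 1, ?_⟩
    rw [Set.mem_ofPred_eq, isolationIndex_set_iff]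
    exact fun t ht _ => Nat.lt_succ_of_le (Finset.le_sup ht)
  exact (isolationIndex_set_iff S s _).1 (Nat.sInf_mem hne) t ht h

theorem isolationIndex_le {S : Finset R} {s : R} {n : ℕ} (h : ∀ t ∈ S, t ≠ s → vd s t < n) :
    isolationIndex S s ≤ n :=
  Nat.sInf_le ((isolationIndex_set_iff S s n).2 h)

theorem IsBalanced.exists_mem {S : Finset R} (hS : IsBalanced S) (r : R) :
    ∃ s ∈ S, r ∈ nbhd s (isolationIndex S s) := by
  have : r ∈ ⋃ s ∈ S, nbhd s (isolationIndex S s) := by rw [hS]; trivial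
  simpa using this

theorem IsBalanced.nonempty {S : Finset R} (hS : IsBalanced S) : S.Nonempty :=
  let ⟨s, hs, _⟩ := hS.exists_mem 0
  ⟨s, hs⟩

/-- Of two balls that meet, the larger contains the center of the smaller, which isolation forbids
for distinct points of `S`. So the isolating neighborhoods are disjoint even when they do not cover
`R`. -/
theorem eq_of_mem_nbhd_isolationIndex {S : Finset R} {s t r : R} (hs : s ∈ S) (ht : t ∈ S)
    (h1 : r ∈ nbhd s (isolationIndex S s)) (h2 : r ∈ nbhd t (isolationIndex S t)) : s = t := by
  have key : ∀ {s t : R}, s ∈ S → t ∈ S → r ∈ nbhd s (isolationIndex S s) →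
      r ∈ nbhd t (isolationIndex S t) → isolationIndex S s ≤ isolationIndex S t → s = t := by
    intro s t hs ht h1 h2 hle
    by_contra hne
    have : t ∈ nbhd s (isolationIndex S s) := nbhd_subset h1 hle (mem_nbhd_symm h2)
    rw [mem_nbhd_iff] at this
    have h3 := vd_lt_isolationIndex ht (Ne.symm hne)
    rcases this with h | h
    · exact hne h.symm
    · omega
  rcases le_total (isolationIndex S s) (isolationIndex S t) with h | h
  · exact key hs ht h1 h2 h
  · exact (key ht hs h2 h1 h).symm

/-- The neighborhoods in the definition of a balanced set form the associated partition. -/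
theorem IsBalanced.isAssociatedPartition {S : Finset R} (hS : IsBalanced S) :
    IsAssociatedPartition S {B | ∃ s ∈ S, B = nbhd s (isolationIndex S s)} := by
  refine ⟨⟨?_, fun r => ?_⟩, isolationIndex S, rfl, fun s hs => ⟨⟨s, ?_, s, self_mem_nbhd _ _, hs⟩, ?_⟩⟩
  · rintro ⟨s, _, h⟩
    exact Set.notMem_empty s (h ▸ self_mem_nbhd s _)
  · obtain ⟨s, hs, hr⟩ := hS.exists_mem r
    refine ⟨_, ⟨⟨s, hs, rfl⟩, hr⟩, ?_⟩
    rintro _ ⟨⟨t, ht, rfl⟩, hr'⟩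
    rw [eq_of_mem_nbhd_isolationIndex hs ht hr hr']
  · exact nbhd_subset (self_mem_nbhd _ _) (Nat.le_succ _)
  -- A point on the rim of the neighborhood: its next smaller residue class misses `s`, the only
  -- point of `S` in the neighborhood.
  · obtain ⟨r, hr, hv⟩ := exists_vd_eq s (isolationIndex S s)
    have hmem : r ∈ nbhd s (isolationIndex S s) := mem_nbhd_iff.2 (Or.inr (by rw [vd_comm, hv]))
    have hsub := nbhd_subset hmem (Nat.le_succ _)
    refine ⟨r, hsub, Set.disjoint_left.2 fun t ht htS => ?_⟩
    have hts : t = s := (eq_of_mem_nbhd_isolationIndex hs htS (hsub ht) (self_mem_nbhd _ _)).symm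
    subst hts
    rw [mem_nbhd_iff, hv] at ht
    rcases ht with h | h
    · exact hr h.symm
    · omega

/-- A balanced set has only one associated partition. -/
theorem IsBalanced.eq_isolationIndex {S : Finset R} (hS : IsBalanced S) {P : Set (Set R)}
    (hP : IsAssociatedPartition S P) {s : R} (hs : s ∈ S) {k : ℕ} (hk : nbhd s k ∈ P) :
    k = isolationIndex S s := by
  obtain ⟨hpart, n, rfl, hn⟩ := hP
  -- Take a residue class in the block of `s` that misses `S`. The isolating neighborhood meeting it
  -- has its center outside that class, so it is large enough to contain the whole block, and
  -- therefore is centered at `s`.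
  have hle : ∀ s ∈ S, isolationIndex S s ≤ n s := by
    intro s hs
    obtain ⟨r, hr, hdisj⟩ := (hn s hs).2
    obtain ⟨t, ht, hrt⟩ := hS.exists_mem r
    have hlt : isolationIndex S t ≤ n s := by
      by_contra! hlt
      exact Set.disjoint_left.1 hdisj
        (nbhd_subset (self_mem_nbhd r _) (Nat.succ_le_of_lt hlt) (mem_nbhd_symm hrt)) ht
    have hst : s ∈ nbhd t (isolationIndex S t) :=
      nbhd_subset hrt hlt (mem_nbhd_symm (hr (self_mem_nbhd _ _)))
    obtain rfl := eq_of_mem_nbhd_isolationIndex hs ht (self_mem_nbhd _ _) hst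
    exact hlt
  -- The blocks cover `R` and each lies inside its isolating neighborhood; as those are disjoint,
  -- neighborhood and block coincide.
  have hge : ∀ s ∈ S, n s ≤ isolationIndex S s := by
    intro s hs
    refine nbhd_le_of_subset (s := s) fun r hr => ?_
    obtain ⟨B, ⟨⟨t, ht, rfl⟩, hrt⟩, -⟩ := hpart.2 r
    rwa [eq_of_mem_nbhd_isolationIndex hs ht hr (nbhd_subset (self_mem_nbhd _ _) (hle t ht) hrt)]
  have hmem : nbhd s (n s) ∈ {B | ∃ s ∈ S, B = nbhd s (n s)} := ⟨s, hs, rfl⟩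
  have := (hpart.2 s).unique ⟨hk, self_mem_nbhd _ _⟩ ⟨hmem, self_mem_nbhd _ _⟩
  rw [nbhd_injective s this]
  exact le_antisymm (hge s hs) (hle s hs)

/-- Points outside `S` at a prescribed small distance from a given point. -/
theorem exists_notMem_vd_eq (S : Finset R) (s : R) {n : ℕ} (hn : ∀ t ∈ S, t ≠ s → vd s t < n) :
    ∃ r ∉ S, vd r s = n ∧ ∀ t ∈ S, t ≠ s → vd r t = vd s t := by
  obtain ⟨r, hr, hv⟩ := exists_vd_eq s n
  have h : ∀ t ∈ S, t ≠ s → vd r t = vd s t := fun t ht hts =>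
    vd_eq_of_gt hts.symm (by rw [hv]; exact hn t ht hts)
  refine ⟨r, fun hrS => ?_, hv, h⟩
  have := hn r hrS hr
  rw [vd_comm, hv] at this
  exact lt_irrefl _ this

/-- The valuation of `∏ s ∈ S, (r - s) ^ m s` for `r ∉ S`. -/
noncomputable def valAt (S : Finset R) (m : R → ℕ) (r : R) : ℕ :=
  ∑ s ∈ S, m s * vd r s

end Valuation

/-! ### The valuation on the quotient field -/

section FractionField

variable {R K : Type*} [CommRing R] [IsDomain R] [IsDiscreteValuationRing R] [Field K] [Algebra R K]
  [IsFractionRing R K]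

variable (R) in
/-- A fixed uniformizer. -/
noncomputable def unif : R := (IsDiscreteValuationRing.exists_irreducible R).choose

variable (R) in
theorem irreducible_unif : Irreducible (unif R) :=
  (IsDiscreteValuationRing.exists_irreducible R).choose_spec

variable (R K) in
theorem algebraMap_unif_ne_zero : algebraMap R K (unif R) ≠ 0 := by
  simpa using (irreducible_unif R).ne_zero

theorem algebraMap_unit_ne_zero (u : Rˣ) : algebraMap R K u ≠ 0 := by simp

theorem unit_mul_zpow_mem_range_iff (u : Rˣ) (n : ℤ) :
    algebraMap R K u * algebraMap R K (unif R) ^ n ∈ (algebraMap R K).range ↔ 0 ≤ n := by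
  constructor
  · rintro ⟨r, hr⟩
    by_contra! hn
    obtain ⟨k, rfl⟩ : ∃ k : ℕ, n = -(k + 1 : ℕ) := ⟨(-n - 1).toNat, by omega⟩
    rw [zpow_neg, zpow_natCast, ← div_eq_mul_inv,
      eq_div_iff (pow_ne_zero _ (algebraMap_unif_ne_zero R K)), ← map_pow, ← map_mul] at hr
    have hr := IsFractionRing.injective R K hr
    refine (irreducible_unif R).not_isUnit (isUnit_of_dvd_unit ?_ u.isUnit)
    rw [← hr, pow_succ, ← mul_assoc]
    exact dvd_mul_left _ _
  · intro hn
    lift n to ℕ using hn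
    exact ⟨u * unif R ^ n, by simp⟩

theorem unit_mul_zpow_injective {u w : Rˣ} {n k : ℤ}
    (h : algebraMap R K u * algebraMap R K (unif R) ^ n =
      algebraMap R K w * algebraMap R K (unif R) ^ k) : n = k := by
  have key : ∀ {u w : Rˣ} {n k : ℤ}, algebraMap R K u * algebraMap R K (unif R) ^ n =
      algebraMap R K w * algebraMap R K (unif R) ^ k → k ≤ n := by
    intro u w n k h
    rw [← sub_nonneg, ← unit_mul_zpow_mem_range_iff (K := K) u,
      zpow_sub₀ (algebraMap_unif_ne_zero R K), ← mul_div_assoc, h,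
      mul_div_cancel_right₀ _ (zpow_ne_zero _ (algebraMap_unif_ne_zero R K))]
    exact ⟨w, rfl⟩
  exact le_antisymm (key h.symm) (key h)

variable (R) in
theorem exists_eq_unit_mul_zpow {c : K} (hc : c ≠ 0) : ∃ (n : ℤ) (u : Rˣ),
    c = algebraMap R K u * algebraMap R K (unif R) ^ n := by
  obtain ⟨n, u, h⟩ :=
    IsDiscreteValuationRing.exists_units_eq_smul_zpow_of_irreducible (irreducible_unif R) hc
  exact ⟨n, u, by rw [h, Units.smul_def, Algebra.smul_def]⟩

open Classical in
variable (R) in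
/-- The valuation on the quotient field (with value `0` at `0`). -/
noncomputable def fracVal (c : K) : ℤ :=
  if hc : c ≠ 0 then (exists_eq_unit_mul_zpow R hc).choose else 0

theorem exists_eq_unit_mul_fracVal {c : K} (hc : c ≠ 0) : ∃ u : Rˣ,
    c = algebraMap R K u * algebraMap R K (unif R) ^ fracVal R c := by
  rw [fracVal, dif_pos hc]
  exact (exists_eq_unit_mul_zpow R hc).choose_spec

theorem fracVal_unit_mul_zpow (u : Rˣ) (n : ℤ) :
    fracVal R (algebraMap R K u * algebraMap R K (unif R) ^ n) = n := by
  obtain ⟨w, hw⟩ := exists_eq_unit_mul_fracVal (R := R)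
    (mul_ne_zero (algebraMap_unit_ne_zero (K := K) u)
      (zpow_ne_zero n (algebraMap_unif_ne_zero R K)))
  exact (unit_mul_zpow_injective hw).symm

theorem fracVal_zpow (n : ℤ) : fracVal R (algebraMap R K (unif R) ^ n) = n := by
  have := fracVal_unit_mul_zpow (K := K) (1 : Rˣ) n
  simpa using this

theorem fracVal_unit (u : Rˣ) : fracVal R (algebraMap R K u) = 0 := by
  have := fracVal_unit_mul_zpow (K := K) u 0
  simpa using this

theorem fracVal_mul {c d : K} (hc : c ≠ 0) (hd : d ≠ 0) :
    fracVal R (c * d) = fracVal R c + fracVal R d := by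
  obtain ⟨u, hu⟩ := exists_eq_unit_mul_fracVal (R := R) hc
  obtain ⟨w, hw⟩ := exists_eq_unit_mul_fracVal (R := R) hd
  rw [← fracVal_unit_mul_zpow (K := K) (u * w) (fracVal R c + fracVal R d),
    zpow_add₀ (algebraMap_unif_ne_zero R K), Units.val_mul, map_mul, mul_mul_mul_comm, ← hu, ← hw]

variable (R) in
theorem fracVal_one : fracVal R (1 : K) = 0 := by
  simpa using fracVal_unit (K := K) (1 : Rˣ)

theorem fracVal_pow {c : K} (hc : c ≠ 0) (n : ℕ) : fracVal R (c ^ n) = n * fracVal R c := by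
  induction n with
  | zero => simp [fracVal_one]
  | succ n ih =>
    rw [pow_succ, fracVal_mul (pow_ne_zero _ hc) hc, ih]
    push_cast
    ring

theorem fracVal_prod {ι : Type*} (s : Finset ι) (f : ι → K) (hf : ∀ i ∈ s, f i ≠ 0) :
    fracVal R (∏ i ∈ s, f i) = ∑ i ∈ s, fracVal R (f i) := by
  classical
  induction s using Finset.induction_on with
  | empty => simp [fracVal_one]
  | insert i s hi ih =>
    have hs := fun j hj => hf j (Finset.mem_insert_of_mem hj)
    rw [Finset.prod_insert hi, Finset.sum_insert hi,
      fracVal_mul (hf i (Finset.mem_insert_self _ _)) (Finset.prod_ne_zero_iff.2 hs), ih hs]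

theorem mem_range_iff_fracVal_nonneg {c : K} (hc : c ≠ 0) :
    c ∈ (algebraMap R K).range ↔ 0 ≤ fracVal R c := by
  obtain ⟨u, hu⟩ := exists_eq_unit_mul_fracVal (R := R) hc
  rw [← unit_mul_zpow_mem_range_iff (K := K) u, ← hu]

theorem fracVal_eq_zero_iff {c : K} (hc : c ≠ 0) :
    fracVal R c = 0 ↔ ∃ u : Rˣ, c = algebraMap R K u := by
  constructor
  · intro h
    obtain ⟨u, hu⟩ := exists_eq_unit_mul_fracVal (R := R) hc
    exact ⟨u, by rw [hu, h, zpow_zero, mul_one]⟩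
  · rintro ⟨u, rfl⟩
    exact fracVal_unit u

theorem fracVal_sub {r s : R} (h : r ≠ s) :
    fracVal R (algebraMap R K r - algebraMap R K s) = vd r s := by
  obtain ⟨n, u, hu⟩ := IsDiscreteValuationRing.eq_unit_mul_pow_irreducible (sub_ne_zero.2 h)
    (irreducible_unif R)
  rw [← map_sub, vd, hu, IsDiscreteValuationRing.addVal_def' u (irreducible_unif R),
    ENat.toNat_natCast, map_mul, map_pow, ← zpow_natCast, fracVal_unit_mul_zpow]

end FractionField

/-! ### Polynomials whose roots lie in a fixed finite set -/

section SplitPoly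

variable {R K : Type*} [CommRing R] [Field K] [Algebra R K]

/-- The polynomial `c ∏ s ∈ S, (x - s) ^ m s`. -/
noncomputable def splitPoly (S : Finset R) (m : R → ℕ) (c : K) : K[X] :=
  C c * ∏ s ∈ S, (X - C (algebraMap R K s)) ^ m s

theorem splitPoly_mul (S : Finset R) (m n : R → ℕ) (c d : K) :
    splitPoly S m c * splitPoly S n d = splitPoly S (m + n) (c * d) := by
  simp only [splitPoly, Pi.add_apply, pow_add, Finset.prod_mul_distrib, C_mul]
  ring

theorem splitPoly_pow (S : Finset R) (m : R → ℕ) (c : K) (n : ℕ) :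
    splitPoly S m c ^ n = splitPoly S (n • m) (c ^ n) := by
  simp only [splitPoly, mul_pow, Pi.smul_apply, smul_eq_mul, ← Finset.prod_pow, C_pow, ← pow_mul,
    mul_comm n]

theorem splitPoly_congr {S : Finset R} {m n : R → ℕ} (h : ∀ s ∈ S, m s = n s) (c : K) :
    splitPoly S m c = splitPoly S n c := by
  rw [splitPoly, splitPoly, Finset.prod_congr rfl fun s hs => by rw [h s hs]]

theorem C_mul_splitPoly (S : Finset R) (m : R → ℕ) (c d : K) :
    C d * splitPoly S m c = splitPoly S m (d * c) := by
  rw [splitPoly, splitPoly, C_mul, mul_assoc]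

theorem prod_X_sub_C_pow_monic (S : Finset R) (m : R → ℕ) :
    (∏ s ∈ S, (X - C (algebraMap R K s)) ^ m s).Monic :=
  monic_prod_of_monic _ _ fun _ _ => (monic_X_sub_C _).pow _

theorem splitPoly_ne_zero (S : Finset R) (m : R → ℕ) {c : K} (hc : c ≠ 0) :
    splitPoly S m c ≠ 0 :=
  mul_ne_zero (C_ne_zero.2 hc) (prod_X_sub_C_pow_monic S m).ne_zero

theorem splitPoly_leadingCoeff (S : Finset R) (m : R → ℕ) (c : K) :
    (splitPoly S m c).leadingCoeff = c := by
  rw [splitPoly, leadingCoeff_mul, (prod_X_sub_C_pow_monic S m).leadingCoeff, leadingCoeff_C,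
    mul_one]

theorem splitPoly_natDegree (S : Finset R) (m : R → ℕ) {c : K} (hc : c ≠ 0) :
    (splitPoly S m c).natDegree = ∑ s ∈ S, m s := by
  rw [splitPoly, natDegree_C_mul hc, natDegree_prod_of_monic _ _ fun _ _ => (monic_X_sub_C _).pow _]
  simp

theorem splitPoly_eval (S : Finset R) (m : R → ℕ) (c : K) (x : K) :
    (splitPoly S m c).eval x = c * ∏ s ∈ S, (x - algebraMap R K s) ^ m s := by
  simp [splitPoly, eval_prod]

theorem splitPoly_splits (S : Finset R) (m : R → ℕ) (c : K) : (splitPoly S m c).Splits :=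
  (Splits.prod fun _ _ => (Splits.X_sub_C _).pow _).C_mul c

theorem splitPoly_rootSet {S : Finset R} {m : R → ℕ} (hm : ∀ s ∈ S, 0 < m s) {c : K} (hc : c ≠ 0) :
    {x : K | (splitPoly S m c).IsRoot x} = algebraMap R K '' S := by
  ext x
  rw [Set.mem_ofPred_eq, IsRoot.def, splitPoly_eval, mul_eq_zero, or_iff_right hc,
    Finset.prod_eq_zero_iff]
  constructor
  · rintro ⟨s, hs, h⟩
    exact ⟨s, hs, (sub_eq_zero.1 (eq_zero_of_pow_eq_zero h)).symm⟩
  · rintro ⟨s, hs, rfl⟩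
    exact ⟨s, hs, by rw [sub_self, zero_pow (hm s hs).ne']⟩

variable [IsFractionRing R K]

theorem splitPoly_rootMultiplicity {S : Finset R} (m : R → ℕ) {c : K} (hc : c ≠ 0) {s : R}
    (hs : s ∈ S) : (splitPoly S m c).rootMultiplicity (algebraMap R K s) = m s := by
  classical
  rw [splitPoly, rootMultiplicity_mul (splitPoly_ne_zero S m hc), rootMultiplicity_C, zero_add,
    ← Finset.mul_prod_erase S _ hs, rootMultiplicity_mul, rootMultiplicity_X_sub_C_pow,
    rootMultiplicity_eq_zero, add_zero]
  · rw [IsRoot.def, eval_prod, Finset.prod_eq_zero_iff]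
    rintro ⟨t, ht, h⟩
    rw [eval_pow, eval_sub, eval_X, eval_C] at h
    exact Finset.ne_of_mem_erase ht
      (IsFractionRing.injective R K (sub_eq_zero.1 (eq_zero_of_pow_eq_zero h)).symm)
  · rw [Finset.mul_prod_erase S (fun t => (X - C (algebraMap R K t)) ^ m t) hs]
    exact (prod_X_sub_C_pow_monic S m).ne_zero

theorem splitPoly_inj {S : Finset R} {m n : R → ℕ} {c d : K} (hc : c ≠ 0) (hd : d ≠ 0)
    (h : splitPoly S m c = splitPoly S n d) : ∀ s ∈ S, m s = n s := fun s hs => by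
  rw [← splitPoly_rootMultiplicity m hc hs, h, splitPoly_rootMultiplicity n hd hs]

/-- A divisor of a split polynomial splits, with roots among those of the multiple; the exponents
are its root multiplicities. -/
theorem exists_eq_splitPoly_of_dvd {S : Finset R} {n : R → ℕ} {c : K} (hc : c ≠ 0) {P : K[X]}
    (h : P ∣ splitPoly S n c) : ∃ (g : R → ℕ) (p : K), p ≠ 0 ∧ P = splitPoly S g p := by
  classical
  have h0 := splitPoly_ne_zero S n hc
  have hP0 : P ≠ 0 := ne_zero_of_dvd_ne_zero h0 h
  refine ⟨fun s => P.roots.count (algebraMap R K s), P.leadingCoeff,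
    leadingCoeff_ne_zero.2 hP0, ?_⟩
  conv_lhs => rw [((splitPoly_splits S n c).of_dvd h0 h).eq_prod_roots, Finset.prod_multiset_map_count]
  rw [splitPoly]
  congr 1
  rw [← Finset.prod_image (s := S) (g := algebraMap R K) (f := fun a => (X - C a) ^ P.roots.count a)
    fun _ _ _ _ h => IsFractionRing.injective R K h]
  refine Finset.prod_subset (fun x hx => ?_) fun x _ hx => ?_
  · rw [Multiset.mem_toFinset, mem_roots hP0] at hx
    have hx := hx.dvd h
    rw [IsRoot.def, splitPoly_eval, mul_eq_zero, or_iff_right hc, Finset.prod_eq_zero_iff] at hx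
    obtain ⟨s, hs, hx⟩ := hx
    exact Finset.mem_image.2 ⟨s, hs, (sub_eq_zero.1 (eq_zero_of_pow_eq_zero hx)).symm⟩
  · rw [Multiset.mem_toFinset] at hx
    rw [Multiset.count_eq_zero_of_notMem hx, pow_zero]

theorem exists_splitPoly_of_mul_eq {S : Finset R} {n : R → ℕ} {c : K} (hc : c ≠ 0) {P Q : K[X]}
    (h : P * Q = splitPoly S n c) : ∃ (g k : R → ℕ) (p q : K), p ≠ 0 ∧ q ≠ 0 ∧
      P = splitPoly S g p ∧ Q = splitPoly S k q ∧ (∀ s ∈ S, g s + k s = n s) ∧ p * q = c := by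
  obtain ⟨g, p, hp, rfl⟩ := exists_eq_splitPoly_of_dvd hc (Dvd.intro _ h)
  obtain ⟨k, q, hq, rfl⟩ := exists_eq_splitPoly_of_dvd hc (Dvd.intro_left _ h)
  refine ⟨g, k, p, q, hp, hq, rfl, rfl, ?_, ?_⟩
  · rw [splitPoly_mul] at h
    exact splitPoly_inj (mul_ne_zero hp hq) hc h
  · rw [← splitPoly_leadingCoeff S n c, ← h, splitPoly_mul, splitPoly_leadingCoeff]

theorem splitPoly_eval_ne_zero {S : Finset R} {m : R → ℕ} {c : K} (hc : c ≠ 0) {r : R}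
    (hr : ∀ s ∈ S, s = r → m s = 0) :
    (splitPoly S m c).eval (algebraMap R K r) ≠ 0 := by
  rw [splitPoly_eval]
  refine mul_ne_zero hc (Finset.prod_ne_zero_iff.2 fun s hs => ?_)
  by_cases h : s = r
  · rw [hr s hs h, pow_zero]
    exact one_ne_zero
  · exact pow_ne_zero _ (sub_ne_zero.2 fun h' => h (IsFractionRing.injective R K h'.symm))

end SplitPoly

/-! ### Image-primitivity over a local ring -/

section ImagePrimitive

variable {R K : Type*} [CommRing R] [IsLocalRing R] [Field K] [Algebra R K]

/-- If no value is a unit, all values lie in the maximal ideal, and so does the ideal they generate.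
-/
theorem isImagePrimitive_iff (F : intValued R K) : IsImagePrimitive F ↔
    ∃ (a : R) (u : Rˣ), (F : K[X]).eval (algebraMap R K a) = algebraMap R K u := by
  rw [IsImagePrimitive, fixedDivisor]
  constructor
  · intro h
    by_contra! hno
    refine (IsLocalRing.maximalIdeal.isMaximal R).ne_top (top_le_iff.1 (h ▸ Ideal.span_le.2 ?_))
    rintro b ⟨a, hb⟩
    refine (IsLocalRing.mem_maximalIdeal b).2 fun hu => ?_
    exact hno a hu.unit hb.symm
  · rintro ⟨a, u, h⟩
    exact Ideal.eq_top_of_isUnit_mem _ (Ideal.subset_span ⟨a, h.symm⟩) u.isUnit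

end ImagePrimitive

/-! ### Integrality and image-primitivity in terms of `valAt` -/

section Integrality

variable {R K : Type*} [CommRing R] [IsDomain R] [IsDiscreteValuationRing R] [Field K] [Algebra R K]
  [IsFractionRing R K]

theorem fracVal_splitPoly_eval {S : Finset R} {m : R → ℕ} {c : K} (hc : c ≠ 0) {r : R}
    (hr : ∀ s ∈ S, s = r → m s = 0) :
    fracVal R ((splitPoly S m c).eval (algebraMap R K r)) = fracVal R c + valAt S m r := by
  have hne := splitPoly_eval_ne_zero hc hr
  rw [splitPoly_eval] at hne ⊢
  have hne' := Finset.prod_ne_zero_iff.1 (right_ne_zero_of_mul hne)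
  rw [fracVal_mul hc (right_ne_zero_of_mul hne), fracVal_prod _ _ hne', valAt, Nat.cast_sum]
  congr 1
  refine Finset.sum_congr rfl fun s hs => ?_
  by_cases h : s = r
  · rw [hr s hs h, pow_zero, fracVal_one, zero_mul, Nat.cast_zero]
  · rw [fracVal_pow (sub_ne_zero.2 fun h' => h (IsFractionRing.injective R K h'.symm)),
      fracVal_sub (Ne.symm h), Nat.cast_mul]

theorem splitPoly_mem_intValued_iff {S : Finset R} {m : R → ℕ} {c : K} (hc : c ≠ 0) :
    splitPoly S m c ∈ intValued R K ↔ ∀ r ∉ S, 0 ≤ fracVal R c + valAt S m r := by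
  have key : ∀ r, (∀ s ∈ S, s = r → m s = 0) →
      ((splitPoly S m c).eval (algebraMap R K r) ∈ (algebraMap R K).range ↔
        0 ≤ fracVal R c + valAt S m r) := fun r hr => by
    rw [mem_range_iff_fracVal_nonneg (splitPoly_eval_ne_zero hc hr), fracVal_splitPoly_eval hc hr]
  have notMem : ∀ r ∉ S, ∀ s ∈ S, s = r → m s = 0 := fun r hr s hs h => absurd (h ▸ hs) hr
  refine ⟨fun h r hr => (key r (notMem r hr)).1 (h r), fun h r => ?_⟩
  by_cases hr : ∀ s ∈ S, s = r → m s = 0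
  · refine (key r hr).2 ?_
    by_cases hrS : r ∈ S
    -- The exponent at `r` vanishes, so `r` may be replaced by a point outside `S` so close to it
    -- that the other factors keep their valuations.
    · obtain ⟨x, hx, -, hv⟩ := exists_notMem_vd_eq S r (n := S.sup (vd r) + 1)
        fun t ht _ => Nat.lt_succ_of_le (Finset.le_sup ht)
      have : valAt S m r = valAt S m x := Finset.sum_congr rfl fun s hs => by
        by_cases h : s = r
        · rw [hr s hs h, zero_mul, zero_mul]
        · rw [hv s hs h]
      rw [this]
      exact h x hx
    · exact h r hrS
  · push Not at hr
    obtain ⟨s, hs, rfl, hm⟩ := hr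
    refine ⟨0, ?_⟩
    rw [map_zero, splitPoly_eval, Finset.prod_eq_zero hs (by rw [sub_self, zero_pow hm]), mul_zero]

theorem isImagePrimitive_splitPoly_iff {S : Finset R} {m : R → ℕ} (hm : ∀ s ∈ S, 0 < m s) {c : K}
    (hc : c ≠ 0) {F : intValued R K} (hF : (F : K[X]) = splitPoly S m c) :
    IsImagePrimitive F ↔ ∃ r ∉ S, fracVal R c + valAt S m r = 0 := by
  have notMem : ∀ r ∉ S, ∀ s ∈ S, s = r → m s = 0 := fun r hr s hs h => absurd (h ▸ hs) hr
  rw [isImagePrimitive_iff, hF]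
  constructor
  · rintro ⟨r, u, h⟩
    have hr : r ∉ S := fun hr => algebraMap_unit_ne_zero (K := K) u (by
      rw [← h, splitPoly_eval,
        Finset.prod_eq_zero hr (by rw [sub_self, zero_pow (hm r hr).ne']), mul_zero])
    exact ⟨r, hr, by rw [← fracVal_splitPoly_eval hc (notMem r hr), h, fracVal_unit]⟩
  · rintro ⟨r, hr, h⟩
    rw [← fracVal_splitPoly_eval hc (notMem r hr),
      fracVal_eq_zero_iff (splitPoly_eval_ne_zero hc (notMem r hr))] at h
    exact ⟨r, h⟩

end Integrality

/-! ### The isolation matrix and its weight vectors -/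

section Weights

variable {R : Type*} [CommRing R] [IsDomain R] [IsDiscreteValuationRing R]

open Classical in
/-- The matrix with the isolation indices on the diagonal and valuations of differences
elsewhere. -/
noncomputable def isoMatrix (S : Finset R) (s t : R) : ℕ :=
  if s = t then isolationIndex S s else vd s t

/-- The coordinate at `s` of the product of `isoMatrix S` with a vector. -/
noncomputable def rowVal (S : Finset R) (m : R → ℕ) (s : R) : ℕ :=
  ∑ t ∈ S, m t * isoMatrix S s t

theorem isoMatrix_self (S : Finset R) (s : R) : isoMatrix S s s = isolationIndex S s := if_pos rfl

theorem isoMatrix_of_ne (S : Finset R) {s t : R} (h : s ≠ t) : isoMatrix S s t = vd s t := if_neg h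

theorem isoMatrix_comm (S : Finset R) (s t : R) : isoMatrix S s t = isoMatrix S t s := by
  by_cases h : s = t
  · rw [h]
  · rw [isoMatrix_of_ne S h, isoMatrix_of_ne S (Ne.symm h), vd_comm]

theorem isoMatrix_lt (S : Finset R) {s t : R} (ht : t ∈ S) (h : t ≠ s) :
    isoMatrix S s t < isoMatrix S s s := by
  rw [isoMatrix_of_ne S h.symm, isoMatrix_self]
  exact vd_lt_isolationIndex ht h

theorem isoMatrix_ultra (S : Finset R) {s t u : R} (hu : u ∈ S) :
    min (isoMatrix S s u) (isoMatrix S u t) ≤ isoMatrix S s t := by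
  by_cases hst : s = t
  · subst hst
    by_cases hus : u = s
    · subst hus; exact min_le_left _ _
    · exact (min_le_left _ _).trans (isoMatrix_lt S hu hus).le
  by_cases hsu : s = u
  · subst hsu; exact min_le_right _ _
  by_cases hut : u = t
  · subst hut; exact min_le_left _ _
  rw [isoMatrix_of_ne S hst, isoMatrix_of_ne S hsu, isoMatrix_of_ne S hut]
  exact vd_ultra hst u

/-- The witness has valuation exactly `isolationIndex S s` relative to `s`, and hence the same
valuations as `s` relative to the other points of `S`. -/
theorem exists_valAt_eq_rowVal (S : Finset R) (s : R) :
    ∃ r ∉ S, ∀ m, valAt S m r = rowVal S m s := by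
  obtain ⟨r, hr, hv, h⟩ := exists_notMem_vd_eq S s (n := isolationIndex S s)
    fun t ht hts => vd_lt_isolationIndex ht hts
  refine ⟨r, hr, fun m => Finset.sum_congr rfl fun t ht => ?_⟩
  by_cases hts : t = s
  · rw [hts, isoMatrix_self, hv]
  · rw [h t ht hts, isoMatrix_of_ne S (Ne.symm hts)]

theorem IsBalanced.exists_rowVal_le {S : Finset R} (hS : IsBalanced S) {r : R} (hr : r ∉ S) :
    ∃ s ∈ S, ∀ m, rowVal S m s ≤ valAt S m r := by
  obtain ⟨s, hs, h⟩ := hS.exists_mem r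
  have hrs : r ≠ s := fun h => hr (h ▸ hs)
  have h := (mem_nbhd_iff.1 h).resolve_left hrs
  refine ⟨s, hs, fun m => Finset.sum_le_sum fun t ht => Nat.mul_le_mul_left _ ?_⟩
  by_cases hts : s = t
  · rw [← hts, isoMatrix_self, vd_comm]
    exact h
  · rw [isoMatrix_of_ne S hts]
    have := vd_lt_isolationIndex ht (Ne.symm hts)
    exact (vd_eq_of_gt (r := r) hts (by rw [vd_comm r s]; omega)).ge

/-- The vectors of positive integers with greatest common divisor `1` and constant image under
`isoMatrix S`. -/
structure IsWeight (S : Finset R) (m : R → ℕ) (e : ℕ) : Prop where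
  pos : ∀ s ∈ S, 0 < m s
  gcd_eq_one : S.gcd m = 1
  rowVal_eq : ∀ s ∈ S, rowVal S m s = e

/-- Raising every entry by one makes the diagonal positive even when an isolation index is `0`, as
for a singleton. It preserves constancy of the image: the right-hand side only grows by the sum of
the coordinates. -/
theorem exists_pos_solution_isoMatrix {S : Finset R} (hS : S.Nonempty) :
    ∃ μ : R → ℚ, (∀ s ∈ S, 0 < μ s) ∧ (∀ s ∈ S, ∑ t ∈ S, (isoMatrix S s t + 1 : ℚ) * μ t = 1) ∧
      ∀ (g : R → ℕ) (a : ℕ), (∀ s ∈ S, rowVal S g s = a) →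
        ∀ s ∈ S, (g s : ℚ) = (a + ∑ t ∈ S, g t : ℕ) * μ s := by
  classical
  obtain ⟨μ, h1, h2, h3⟩ := exists_pos_solution_of_ultrametric S hS
    (fun s t => (isoMatrix S s t + 1 : ℚ))
    (fun s _ t _ => by rw [isoMatrix_comm])
    (fun s _ t _ u hu => by
      rw [min_add_add_right]
      have := isoMatrix_ultra S (s := s) (t := t) hu
      gcongr
      exact_mod_cast this)
    (fun s _ t _ => by positivity) (fun s _ => by positivity)
    (fun s _ t ht hts => by
      have := isoMatrix_lt S ht hts
      gcongr)
  refine ⟨μ, h1, h2, fun g a hg => h3 _ _ fun s hs => ?_⟩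
  rw [← hg s hs, rowVal]
  push_cast
  rw [← Finset.sum_add_distrib]
  exact Finset.sum_congr rfl fun t _ => by ring

theorem IsWeight.exists_eq_mul {S : Finset R} {m g : R → ℕ} {e a : ℕ} (hm : IsWeight S m e)
    (hg : ∀ s ∈ S, rowVal S g s = a) : ∃ k, ∀ s ∈ S, g s = k * m s := by
  rcases S.eq_empty_or_nonempty with rfl | hS
  · exact ⟨0, by simp⟩
  obtain ⟨μ, -, -, h⟩ := exists_pos_solution_isoMatrix hS
  have h1 := h m e hm.rowVal_eq
  have h2 := h g a hg
  set E := e + ∑ t ∈ S, m t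
  set G := a + ∑ t ∈ S, g t
  have hE : 0 < E := Nat.add_pos_right _ (Finset.sum_pos hm.pos hS)
  have hEG : ∀ s ∈ S, E * g s = G * m s := by
    intro s hs
    have : (E : ℚ) * g s = G * m s := by rw [h1 s hs, h2 s hs]; ring
    exact_mod_cast this
  -- Both vectors are multiples of `μ`; taking gcds in `E g = G m` with `m` coprime shows that the
  -- ratio `G / E` is a natural number.
  have hgcd : E * S.gcd g = G := by
    have := Finset.gcd_congr rfl hEG
    rwa [Finset.gcd_mul_left, Finset.gcd_mul_left, hm.gcd_eq_one, normalize_eq, normalize_eq,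
      mul_one] at this
  refine ⟨S.gcd g, fun s hs => ?_⟩
  have := hEG s hs
  rw [← hgcd, mul_assoc] at this
  exact Nat.eq_of_mul_eq_mul_left hE this

theorem IsWeight.unique {S : Finset R} {m g : R → ℕ} {e a : ℕ} (hm : IsWeight S m e)
    (hg : IsWeight S g a) : ∀ s ∈ S, g s = m s := by
  obtain ⟨k, hk⟩ := hm.exists_eq_mul hg.rowVal_eq
  have := Finset.gcd_congr rfl hk
  rw [hg.gcd_eq_one, Finset.gcd_mul_left, hm.gcd_eq_one, normalize_eq, mul_one] at this
  intro s hs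
  rw [hk s hs, ← this, one_mul]

theorem rowVal_smul {S : Finset R} {m g : R → ℕ} {k : ℕ} (h : ∀ s ∈ S, g s = k * m s) (s : R) :
    rowVal S g s = k * rowVal S m s := by
  rw [rowVal, rowVal, Finset.mul_sum]
  exact Finset.sum_congr rfl fun t ht => by rw [h t ht, mul_assoc]

theorem exists_isWeight {S : Finset R} (hS : S.Nonempty) : ∃ m e, IsWeight S m e := by
  obtain ⟨μ, hpos, hμ, -⟩ := exists_pos_solution_isoMatrix hS
  -- Clear the denominators of the rational solution, then divide by the gcd of the resulting
  -- integers.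
  set N := ∏ s ∈ S, (μ s).den with hN
  have hN0 : 0 < N := Finset.prod_pos fun s _ => (μ s).den_pos
  have hint : ∀ s, ∃ k : ℕ, s ∈ S → (k : ℚ) = N * μ s := by
    intro s
    by_cases hs : s ∈ S
    · obtain ⟨q, hq⟩ := Finset.dvd_prod_of_mem (fun s => (μ s).den) hs
      refine ⟨q * (μ s).num.toNat, fun _ => ?_⟩
      have h1 : (((μ s).num.toNat : ℤ) : ℚ) = (μ s).num := by
        rw [Int.toNat_of_nonneg (Rat.num_nonneg.2 (hpos s hs).le)]
      rw [hN, hq, Nat.cast_mul, Nat.cast_mul, ← Int.cast_natCast (μ s).num.toNat, h1]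
      have := Rat.den_mul_eq_num (μ s)
      rw [← this]
      ring
    · exact ⟨0, fun h => absurd h hs⟩
  choose M hM using hint
  have hM0 : ∀ s ∈ S, 0 < M s := fun s hs => by
    have : (0 : ℚ) < M s := by rw [hM s hs]; exact mul_pos (by exact_mod_cast hN0) (hpos s hs)
    exact_mod_cast this
  obtain ⟨m, hm, hgcd⟩ := Finset.extract_gcd M hS
  have hg0 : 0 < S.gcd M := by
    obtain ⟨s, hs⟩ := hS
    exact Nat.pos_of_ne_zero fun h => by
      have := hm s hs
      rw [h, zero_mul] at this
      exact (hM0 s hs).ne' this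
  have hrow : ∀ s ∈ S, rowVal S M s = N - ∑ t ∈ S, M t := by
    intro s hs
    have : ((rowVal S M s + ∑ t ∈ S, M t : ℕ) : ℚ) = N := by
      rw [← mul_one (N : ℚ), ← hμ s hs, Finset.mul_sum, rowVal]
      push_cast
      rw [← Finset.sum_add_distrib]
      refine Finset.sum_congr rfl fun t ht => ?_
      rw [hM t ht]
      ring
    have : rowVal S M s + ∑ t ∈ S, M t = N := by exact_mod_cast this
    omega
  obtain ⟨s₀, hs₀⟩ := hS
  refine ⟨m, rowVal S m s₀, fun s hs => ?_, hgcd, fun s hs => ?_⟩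
  · refine Nat.pos_of_ne_zero fun h => ?_
    have := hm s hs
    rw [h, mul_zero] at this
    exact (hM0 s hs).ne' this
  · have h1 := hrow s hs
    rw [← hrow s₀ hs₀, rowVal_smul hm, rowVal_smul hm] at h1
    exact Nat.eq_of_mul_eq_mul_left hg0 h1

end Weights

/-! ### Equalizing polynomials as weight vectors -/

section Equalizing

theorem gcd_univ_coe {α : Type*} (S : Finset α) (m : α → ℕ) :
    (Finset.univ : Finset S).gcd (fun s => m s) = S.gcd m := by
  refine Nat.dvd_antisymm (Finset.dvd_gcd fun s hs => ?_) (Finset.dvd_gcd fun s _ => ?_)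
  · exact Finset.gcd_dvd (f := fun s : S => m s) (Finset.mem_univ ⟨s, hs⟩)
  · exact Finset.gcd_dvd s.2

variable {R K : Type*} [CommRing R] [IsDomain R] [IsDiscreteValuationRing R] [Field K] [Algebra R K]

theorem partitionMatrix_eq_isoMatrix {S : Finset R} {ρ : S → ℕ}
    (hρ : ∀ s : S, ρ s = isolationIndex S s) (s t : S) :
    partitionMatrix S ρ s t = isoMatrix S s t := by
  by_cases h : s = t
  · subst h
    simp [partitionMatrix, isoMatrix_self, hρ]
  · rw [isoMatrix_of_ne S fun h' => h (Subtype.ext h')]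
    simp [partitionMatrix, h, vd]

theorem mulVec_partitionMatrix {S : Finset R} {ρ : S → ℕ}
    (hρ : ∀ s : S, ρ s = isolationIndex S s) (m : R → ℕ) (s : S) :
    (partitionMatrix S ρ).mulVec (fun t : S => m t) s = rowVal S m s := by
  rw [Matrix.mulVec, dotProduct, rowVal,
    ← Finset.sum_coe_sort S fun t => m t * isoMatrix S s t]
  exact Finset.sum_congr rfl fun t _ => by rw [partitionMatrix_eq_isoMatrix hρ, mul_comm]

theorem IsBalanced.isEqualizingPolynomial_iff {S : Finset R} (hS : IsBalanced S)
    {f : intValued R K} :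
    IsEqualizingPolynomial S f ↔ ∃ m e, IsWeight S m e ∧ (f : K[X]) = splitPoly S m 1 := by
  classical
  constructor
  · rintro ⟨P, ρ, hP, hρ, m, e, hm, hgcd, he, hf⟩
    have hρ' : ∀ s : S, ρ s = isolationIndex S s := fun s => hS.eq_isolationIndex hP s.2 (hρ s)
    let m' : R → ℕ := fun s => if h : s ∈ S then m ⟨s, h⟩ else 0
    have hm' : m = fun s : S => m' s := by
      funext s
      simp [m']
    refine ⟨m', e, ⟨fun s hs => ?_, ?_, fun s hs => ?_⟩, ?_⟩
    · simpa [m', hs] using hm ⟨s, hs⟩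
    · rw [← gcd_univ_coe, ← hm', hgcd]
    · have := congrFun he ⟨s, hs⟩
      rwa [hm', mulVec_partitionMatrix hρ'] at this
    · rw [hf, hm', splitPoly, C_1, one_mul,
        ← Finset.prod_coe_sort S fun s => (X - C (algebraMap R K s)) ^ m' s]
  · rintro ⟨m, e, hm, hf⟩
    refine ⟨_, fun s => isolationIndex S s, hS.isAssociatedPartition, fun s => ⟨s, s.2, rfl⟩,
      fun s => m s, e, fun s => hm.pos s s.2, ?_, ?_, ?_⟩
    · rw [gcd_univ_coe, hm.gcd_eq_one]
    · funext s
      rw [mulVec_partitionMatrix fun _ => rfl, hm.rowVal_eq s s.2]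
    · rw [hf, splitPoly, C_1, one_mul,
        ← Finset.prod_coe_sort S fun s => (X - C (algebraMap R K s)) ^ m s]

end Equalizing

/-! ### Units and associates in the ring of integer-valued polynomials -/

section IntValued

variable {R K : Type*} [CommRing R] [Field K] [Algebra R K]

theorem associated_of_coe_eq {F G : intValued R K} (u : Rˣ)
    (h : (G : K[X]) = C (algebraMap R K u) * (F : K[X])) : Associated F G := by
  refine ⟨Units.map (algebraMap R (intValued R K)).toMonoidHom u, Subtype.ext ?_⟩
  rw [h, mul_comm]
  rfl

theorem natDegree_eq_zero_of_isUnit {F : intValued R K} (h : IsUnit F) :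
    (F : K[X]).natDegree = 0 :=
  Polynomial.natDegree_eq_zero_of_isUnit (h.map (intValued R K).val)

theorem natDegree_eq_of_associated {F G : intValued R K} (h : Associated F G) :
    (F : K[X]).natDegree = (G : K[X]).natDegree :=
  natDegree_eq_of_degree_eq (degree_eq_degree_of_associated (h.map (intValued R K).val))

end IntValued

theorem associated_prod_pow_card {M : Type*} [CommMonoid M] {a : M} {l : Multiset M}
    (h : ∀ b ∈ l, Associated b a) : Associated l.prod (a ^ l.card) := by
  induction l using Multiset.induction with
  | empty => simp
  | cons b l ih =>
    rw [Multiset.prod_cons, Multiset.card_cons, pow_succ']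
    exact (h b (Multiset.mem_cons_self _ _)).mul_mul
      (ih fun c hc => h c (Multiset.mem_cons_of_mem hc))

/-! ### Weight vectors give absolutely irreducible polynomials -/

section AbsolutelyIrreducibleOfWeight

variable {R K : Type*} [CommRing R] [IsDomain R] [IsDiscreteValuationRing R] [Field K] [Algebra R K]
  [IsFractionRing R K]

theorem fracVal_add_rowVal_nonneg {S : Finset R} {m : R → ℕ} {c : K} (hc : c ≠ 0)
    (h : splitPoly S m c ∈ intValued R K) (s : R) : 0 ≤ fracVal R c + rowVal S m s := by
  obtain ⟨r, hr, hv⟩ := exists_valAt_eq_rowVal S s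
  rw [← hv]
  exact (splitPoly_mem_intValued_iff hc).1 h r hr

theorem exists_unit_mul_of_fracVal_eq {c d : K} (hc : c ≠ 0) (hd : d ≠ 0)
    (h : fracVal R c = fracVal R d) : ∃ u : Rˣ, d = algebraMap R K u * c := by
  have h0 : fracVal R (d / c) = 0 := by
    have := fracVal_mul (R := R) (div_ne_zero hd hc) hc
    rw [div_mul_cancel₀ _ hc] at this
    omega
  obtain ⟨u, hu⟩ := (fracVal_eq_zero_iff (div_ne_zero hd hc)).1 h0
  exact ⟨u, by rw [← hu, div_mul_cancel₀ _ hc]⟩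

/-- The divisors of the powers of the image-primitive polynomial belonging to a weight vector. -/
theorem IsWeight.exists_associated_pow {S : Finset R} {m : R → ℕ} {e : ℕ}
    (hm : IsWeight S m e) {c : K} (hc : c ≠ 0) (hce : fracVal R c = -e)
    {F : intValued R K} (hF : (F : K[X]) = splitPoly S m c) {J H : intValued R K} {N : ℕ}
    (h : J * H = F ^ N) : ∃ k, Associated J (F ^ k) := by
  have hmul : (J : K[X]) * (H : K[X]) = splitPoly S (N • m) (c ^ N) := by
    rw [← splitPoly_pow, ← hF]
    exact congrArg Subtype.val h
  obtain ⟨g, k, p, q, hp, hq, hJ, hH, hgk, hpq⟩ := exists_splitPoly_of_mul_eq (pow_ne_zero _ hc) hmul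
  have hval : fracVal R p + fracVal R q = -(N * e) := by
    rw [← fracVal_mul hp hq, hpq, fracVal_pow hc, hce, mul_neg]
  -- The rows for `g` and `k` are at least `-v(p)` and `-v(q)`, and they add up to `N e = -v(p) -
  -- v(q)`; so both bounds are equalities.
  have hrow : ∀ s ∈ S, (rowVal S g s : ℤ) = -fracVal R p := by
    intro s hs
    have h1 := fracVal_add_rowVal_nonneg hp (hJ ▸ J.2) s
    have h2 := fracVal_add_rowVal_nonneg hq (hH ▸ H.2) s
    have h3 : rowVal S g s + rowVal S k s = N * e := by
      rw [← hm.rowVal_eq s hs, ← rowVal_smul (g := fun s => g s + k s) hgk, rowVal, rowVal, rowVal,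
        ← Finset.sum_add_distrib]
      exact Finset.sum_congr rfl fun t _ => by ring
    have h3 : (rowVal S g s : ℤ) + rowVal S k s = N * e := by exact_mod_cast h3
    omega
  obtain ⟨a, ha⟩ := hm.exists_eq_mul (g := g) (a := (-fracVal R p).toNat) fun s hs => by
    have := hrow s hs
    omega
  refine ⟨a, ?_⟩
  have hpa : fracVal R p = fracVal R (c ^ a) := by
    obtain ⟨s, hs⟩ : S.Nonempty := by
      rw [Finset.nonempty_iff_ne_empty]
      rintro rfl
      simpa using hm.gcd_eq_one
    have h1 := hrow s hs
    rw [rowVal_smul ha, hm.rowVal_eq s hs] at h1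
    rw [fracVal_pow hc, hce]
    push_cast at h1
    linarith
  obtain ⟨u, hu⟩ := exists_unit_mul_of_fracVal_eq hp (pow_ne_zero a hc) hpa
  refine associated_of_coe_eq u ?_
  rw [hJ, C_mul_splitPoly, ← hu, SubmonoidClass.coe_pow, hF, splitPoly_pow]
  exact splitPoly_congr (fun s hs => (ha s hs).symm) _

/-- All divisors of powers of `F` are powers of `F` up to units. Since `F` has positive degree, the
degree determines the exponent, and irreducible divisors have exponent one. -/
theorem IsWeight.isAbsolutelyIrreducible {S : Finset R} {m : R → ℕ} {e : ℕ}
    (hm : IsWeight S m e) {c : K} (hc : c ≠ 0) (hce : fracVal R c = -e)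
    {F : intValued R K} (hF : (F : K[X]) = splitPoly S m c) : IsAbsolutelyIrreducible F := by
  have hS : S.Nonempty := by
    rw [Finset.nonempty_iff_ne_empty]
    rintro rfl
    simpa using hm.gcd_eq_one
  have hdeg : 0 < (F : K[X]).natDegree := by
    rw [hF, splitPoly_natDegree S m hc]
    exact Finset.sum_pos hm.pos hS
  have hnu : ¬ IsUnit F := fun h => hdeg.ne' (natDegree_eq_zero_of_isUnit h)
  have hdvd : ∀ {J : intValued R K} {N : ℕ}, J ∣ F ^ N → ∃ k, Associated J (F ^ k) := by
    rintro J N ⟨H, h⟩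
    exact hm.exists_associated_pow hc hce hF h.symm
  have hdegpow : ∀ {J : intValued R K} {k : ℕ}, Associated J (F ^ k) →
      (J : K[X]).natDegree = k * (F : K[X]).natDegree := fun h => by
    rw [natDegree_eq_of_associated h, SubmonoidClass.coe_pow, natDegree_pow]
  have hF0 : (F : K[X]) ≠ 0 := by
    rw [hF]
    exact splitPoly_ne_zero S m hc
  have hirr : Irreducible F := by
    refine ⟨hnu, fun A B hAB => ?_⟩
    obtain ⟨i, hi⟩ := hdvd (N := 1) (J := A) (by rw [pow_one, hAB]; exact dvd_mul_right _ _)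
    obtain ⟨j, hj⟩ := hdvd (N := 1) (J := B) (by rw [pow_one, hAB]; exact dvd_mul_left _ _)
    have hcoe : (F : K[X]) = A * B := congrArg Subtype.val hAB
    have hAB0 := mul_ne_zero_iff.1 (hcoe ▸ hF0)
    have hsum := congrArg natDegree hcoe
    rw [natDegree_mul hAB0.1 hAB0.2, hdegpow hi, hdegpow hj, ← add_mul] at hsum
    have hij : i + j = 1 := by
      refine Nat.eq_of_mul_eq_mul_right hdeg ?_
      rw [one_mul, ← hsum]
    rcases Nat.eq_zero_or_pos i with rfl | h
    · left
      rw [pow_zero] at hi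
      exact associated_one_iff_isUnit.1 hi
    · right
      obtain rfl : j = 0 := by omega
      rw [pow_zero] at hj
      exact associated_one_iff_isUnit.1 hj
  refine ⟨hirr, fun n _ => ?_⟩
  have key : ∀ l : Multiset (intValued R K), (∀ a ∈ l, Irreducible a) → l.prod = F ^ n →
      (∀ a ∈ l, Associated a F) ∧ l.card = n := by
    intro l hl hprod
    have hass : ∀ a ∈ l, Associated a F := by
      intro a ha
      obtain ⟨k, hk⟩ := hdvd (hprod ▸ Multiset.dvd_prod ha)
      have hirr' := hk.irreducible (hl a ha)
      by_cases h1 : k = 1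
      · rwa [h1, pow_one] at hk
      · exact absurd hirr' (not_irreducible_pow h1)
    refine ⟨hass, ?_⟩
    have hp := hdegpow (hprod ▸ associated_prod_pow_card hass)
    rw [SubmonoidClass.coe_pow, natDegree_pow] at hp
    exact (Nat.eq_of_mul_eq_mul_right hdeg hp).symm
  intro l₁ l₂ h₁ h₂ hp₁ hp₂
  obtain ⟨ha₁, hc₁⟩ := key l₁ h₁ hp₁
  obtain ⟨ha₂, hc₂⟩ := key l₂ h₂ hp₂
  exact Multiset.rel_of_forall (fun a b ha hb => (ha₁ a ha).trans (ha₂ b hb).symm) (hc₁.trans hc₂.symm)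

end AbsolutelyIrreducibleOfWeight

/-! ### Extremal exponent vectors -/

section Combinatorics

variable {R : Type*} [CommRing R] [IsDomain R] [IsDiscreteValuationRing R]

theorem valAt_smul {S : Finset R} {m g : R → ℕ} {k : ℕ} (h : ∀ s ∈ S, g s = k * m s) (r : R) :
    valAt S g r = k * valAt S m r := by
  rw [valAt, valAt, Finset.mul_sum]
  exact Finset.sum_congr rfl fun t ht => by rw [h t ht, mul_assoc]

/-- `m` is extremal: whenever a multiple of `m` is decomposed in such a way that the minimum `d` of
`valAt S m` decomposes accordingly, the summands are multiples of `m`. -/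
def IsExtremal (S : Finset R) (m : R → ℕ) (d : ℕ) : Prop :=
  ∀ (N : ℕ) (g h : R → ℕ) (p q : ℤ), 1 ≤ N → (∀ s ∈ S, g s + h s = N * m s) → p + q = N * d →
    (∀ r ∉ S, p ≤ valAt S g r) → (∀ r ∉ S, q ≤ valAt S h r) → ∃ k, ∀ s ∈ S, g s = k * m s

variable {S : Finset R} {m : R → ℕ} {d : ℕ}

/-- Writing `m = γ g`, the decomposition into `g` and `(γ - 1) g` is compatible with the minima.
Extremality gives `g = k m = k γ g`, so `γ = 1`. -/
theorem IsExtremal.gcd_eq_one (hE : IsExtremal S m d) (hS : S.Nonempty) (hm : ∀ s ∈ S, 0 < m s)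
    (hmin : ∀ r ∉ S, d ≤ valAt S m r) (hmin' : ∃ r ∉ S, valAt S m r = d) : S.gcd m = 1 := by
  obtain ⟨g, hg, -⟩ := Finset.extract_gcd m hS
  set γ := S.gcd m
  obtain ⟨s, hs⟩ := hS
  have hγ : 0 < γ := Nat.pos_of_ne_zero fun h => by
    have := hg s hs
    rw [h, zero_mul] at this
    exact (hm s hs).ne' this
  obtain ⟨r₀, hr₀, hv₀⟩ := hmin'
  have hle : ∀ r ∉ S, valAt S g r₀ ≤ valAt S g r := by
    intro r hr
    have := hmin r hr
    rw [← hv₀, valAt_smul hg, valAt_smul hg] at this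
    exact Nat.le_of_mul_le_mul_left this hγ
  rw [valAt_smul hg] at hv₀
  obtain ⟨δ, hδ⟩ : ∃ δ, γ = δ + 1 := ⟨γ - 1, by omega⟩
  obtain ⟨k, hk⟩ := hE 1 g (fun s => δ * g s) (valAt S g r₀) (δ * valAt S g r₀) le_rfl
    (fun s hs => by rw [hg s hs, hδ]; ring) (by rw [← hv₀, hδ]; push_cast; ring)
    (fun r hr => by exact_mod_cast hle r hr)
    (fun r hr => by
      rw [valAt_smul (m := g) (k := δ) fun _ _ => rfl]
      exact_mod_cast Nat.mul_le_mul_left _ (hle r hr))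
  have h1 := hk s hs
  have h2 := hg s hs
  have hg0 : 0 < g s := Nat.pos_of_ne_zero fun h => by
    rw [h, mul_zero] at h2
    exact (hm s hs).ne' h2
  rw [h2, ← mul_assoc] at h1
  have : k * γ = 1 := Nat.eq_of_mul_eq_mul_right hg0 (by rw [← h1, one_mul])
  exact Nat.eq_one_of_mul_eq_one_left this

/-- Perturbing an extremal vector: no nonzero vector is orthogonal to all minimizing rows. -/
theorem IsExtremal.eq_zero (hE : IsExtremal S m d) (hm : ∀ s ∈ S, 0 < m s)
    (hmin : ∀ r ∉ S, d ≤ valAt S m r) (hmin' : ∃ r ∉ S, valAt S m r = d) (δ : R → ℤ)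
    (hδ : ∀ r ∉ S, valAt S m r = d → ∑ s ∈ S, (vd r s + 1 : ℤ) * δ s = 0) : ∀ s ∈ S, δ s = 0 := by
  -- `N₁` makes `N₁ m ± δ` nonnegative. `N₂` is so large that at non-minimizers, where `valAt S m`
  -- is at least `d + 1`, the surplus `N₂` outweighs any loss from the perturbation.
  set N₁ : ℕ := ∑ s ∈ S, (δ s).natAbs with hN₁
  set κ : ℤ := ∑ s ∈ S, δ s with hκ
  set N₂ : ℕ := N₁ * d + κ.natAbs + 1 with hN₂
  have habs : ∀ s ∈ S, |δ s| ≤ N₁ * m s := by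
    intro s hs
    have h1 : (δ s).natAbs ≤ N₁ := Finset.single_le_sum (f := fun s => (δ s).natAbs) (by simp) hs
    have h2 : N₁ * 1 ≤ N₁ * m s := Nat.mul_le_mul_left _ (hm s hs)
    have h3 : ((δ s).natAbs : ℤ) ≤ (N₁ * m s : ℕ) := by exact_mod_cast by omega
    rwa [Int.natCast_natAbs, Nat.cast_mul] at h3
  clear_value N₁ N₂
  -- The entries `vd r s + 1` encode that the perturbation changes the value at each minimizer by
  -- the same amount `-∑ ε`. The bounds for `δ` and `-δ` therefore add up exactly.
  have key : ∀ ε : R → ℤ, (∀ s ∈ S, 0 ≤ N₁ * m s + ε s) →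
      (∀ r ∉ S, valAt S m r = d → ∑ s ∈ S, (vd r s + 1 : ℤ) * ε s = 0) →
      N₁ * d - ∑ s ∈ S, ε s ≤ N₂ → ∀ r ∉ S,
        (N₁ + N₂ : ℤ) * d - ∑ s ∈ S, ε s ≤ valAt S (fun s => ((N₁ + N₂) * m s + ε s).toNat) r := by
    intro ε hε hrow hbound r hr
    have h1 : (valAt S (fun s => ((N₁ + N₂) * m s + ε s).toNat) r : ℤ) =
        ∑ s ∈ S, (N₁ * m s + ε s) * vd r s + N₂ * valAt S m r := by
      rw [valAt, valAt, Nat.cast_sum, Nat.cast_sum, Finset.mul_sum, ← Finset.sum_add_distrib]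
      refine Finset.sum_congr rfl fun s hs => ?_
      have := hε s hs
      rw [Nat.cast_mul, Int.toNat_of_nonneg (by nlinarith [Nat.zero_le (N₂ * m s)]), Nat.cast_mul]
      ring
    rw [h1]
    rcases (hmin r hr).eq_or_lt with h | h
    · have h2 := hrow r hr h.symm
      have h3 : ∑ s ∈ S, (N₁ * m s + ε s) * (vd r s : ℤ) =
          N₁ * valAt S m r + (∑ s ∈ S, (vd r s + 1 : ℤ) * ε s - ∑ s ∈ S, ε s) := by
        rw [valAt, Nat.cast_sum, Finset.mul_sum, ← Finset.sum_sub_distrib, ← Finset.sum_add_distrib]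
        refine Finset.sum_congr rfl fun s _ => ?_
        rw [Nat.cast_mul]
        ring
      rw [h3, h2, ← h]
      linarith
    · have h2 : 0 ≤ ∑ s ∈ S, (N₁ * m s + ε s) * (vd r s : ℤ) :=
        Finset.sum_nonneg fun s hs => mul_nonneg (hε s hs) (by positivity)
      have h3 : (N₂ : ℤ) * (d + 1) ≤ N₂ * valAt S m r := by
        exact_mod_cast Nat.mul_le_mul_left _ h
      linarith
  have hneg : ∑ s ∈ S, -δ s = -κ := by rw [Finset.sum_neg_distrib]
  have hN₂' : (N₂ : ℤ) = N₁ * d + |κ| + 1 := by rw [hN₂]; push_cast; rfl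
  have hg := key δ (fun s hs => by linarith [neg_abs_le (δ s), habs s hs]) hδ
    (by rw [hN₂', ← hκ]; linarith [neg_abs_le κ])
  have hh := key (fun s => -δ s) (fun s hs => by linarith [le_abs_self (δ s), habs s hs])
    (fun r hr h => by
      rw [← neg_eq_zero, ← hδ r hr h, ← Finset.sum_neg_distrib]
      exact Finset.sum_congr rfl fun s _ => by ring)
    (by rw [hN₂', hneg]; linarith [le_abs_self κ])
  have hN0 : ∀ s ∈ S, (0 : ℤ) ≤ (N₁ + N₂) * m s + δ s ∧ (0 : ℤ) ≤ (N₁ + N₂) * m s + -δ s := by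
    intro s hs
    have := abs_le.1 (habs s hs)
    have h2 : (0 : ℤ) ≤ N₂ * m s := by positivity
    constructor <;> linarith
  obtain ⟨k, hk⟩ := hE (2 * (N₁ + N₂)) _ _ _ _ (by omega)
    (fun s hs => by
      zify
      rw [Int.toNat_of_nonneg (hN0 s hs).1, Int.toNat_of_nonneg (hN0 s hs).2]
      ring)
    (by rw [hneg]; push_cast; ring) hg hh
  have hδk : ∀ s ∈ S, δ s = (k - (N₁ + N₂)) * m s := by
    intro s hs
    have := congrArg (Nat.cast : ℕ → ℤ) (hk s hs)
    rw [Int.toNat_of_nonneg (hN0 s hs).1, Nat.cast_mul] at this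
    linarith
  -- Now `δ` is a multiple of `m`, but `m` pairs positively with the row of a minimizer, so the
  -- factor is zero.
  obtain ⟨r₀, hr₀, hv₀⟩ := hmin'
  have h0 := hδ r₀ hr₀ hv₀
  have h1 : ∑ s ∈ S, (vd r₀ s + 1 : ℤ) * δ s =
      (k - (N₁ + N₂)) * ∑ s ∈ S, (vd r₀ s + 1 : ℤ) * m s := by
    rw [Finset.mul_sum]
    exact Finset.sum_congr rfl fun s hs => by rw [hδk s hs]; ring
  intro s hs
  have hpos : 0 < ∑ s ∈ S, (vd r₀ s + 1 : ℤ) * m s :=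
    Finset.sum_pos (fun s hs => mul_pos (by positivity) (by exact_mod_cast hm s hs)) ⟨s, hs⟩
  rw [h1, mul_eq_zero, or_iff_left hpos.ne'] at h0
  rw [hδk s hs, h0, zero_mul]

/-- If `t` is a closest point to `r`, then `vd r u` is the minimum of `vd r t` and `vd t u` for `u ≠
t`, hence monotone in `vd r t`. -/
theorem vd_le_of_maximizer {r r' t : R} (hr : r ∉ S) (hr' : r' ∉ S)
    (hmax : ∀ u ∈ S, vd r u ≤ vd r t) (hmax' : ∀ u ∈ S, vd r' u ≤ vd r' t)
    (h : vd r t ≤ vd r' t) : ∀ u ∈ S, vd r u ≤ vd r' u := by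
  intro u hu
  by_cases hut : t = u
  · exact hut ▸ h
  · rw [vd_eq_min (s := t) (t := u) (by rintro rfl; exact hr hu) hut (hmax u hu),
      vd_eq_min (s := t) (t := u) (by rintro rfl; exact hr' hu) hut (hmax' u hu)]
    exact min_le_min_right _ h

/-- Since all weights are positive, a strict inequality at `t` would make the two values of `valAt`
differ. -/
theorem vd_eq_of_maximizer (hm : ∀ s ∈ S, 0 < m s) {r r' t : R} (hr : r ∉ S) (hr' : r' ∉ S)
    (ht : t ∈ S) (hv : valAt S m r = valAt S m r')
    (hmax : ∀ u ∈ S, vd r u ≤ vd r t) (hmax' : ∀ u ∈ S, vd r' u ≤ vd r' t) :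
    ∀ u ∈ S, vd r u = vd r' u := by
  have key : ∀ {r r' : R}, r ∉ S → r' ∉ S → valAt S m r = valAt S m r' →
      (∀ u ∈ S, vd r u ≤ vd r t) → (∀ u ∈ S, vd r' u ≤ vd r' t) → vd r t ≤ vd r' t := by
    intro r r' hr hr' hv hmax hmax'
    by_contra! hlt
    refine hv.not_gt (Finset.sum_lt_sum (fun u hu => Nat.mul_le_mul_left _
      (vd_le_of_maximizer hr' hr hmax' hmax hlt.le u hu))
      ⟨t, ht, Nat.mul_lt_mul_of_pos_left hlt (hm t ht)⟩)
  exact fun u hu => le_antisymm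
    (vd_le_of_maximizer hr hr' hmax hmax' (key hr hr' hv hmax hmax') u hu)
    (vd_le_of_maximizer hr' hr hmax' hmax (key hr' hr hv.symm hmax' hmax) u hu)

/-- For an extremal vector, every point of `S` is the unique closest point to some minimizer. -/
theorem IsExtremal.exists_minimizer (hE : IsExtremal S m d) (hm : ∀ s ∈ S, 0 < m s)
    (hmin : ∀ r ∉ S, d ≤ valAt S m r) (hmin' : ∃ r ∉ S, valAt S m r = d) {s₀ : R} (hs₀ : s₀ ∈ S) :
    ∃ r ∉ S, valAt S m r = d ∧ ∀ t ∈ S, t ≠ s₀ → vd r t < vd r s₀ := by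
  classical
  by_contra! hno
  have hclose : ∀ r ∉ S, valAt S m r = d → ∃ t ∈ S, t ≠ s₀ ∧ ∀ u ∈ S, vd r u ≤ vd r t := by
    intro r hr hv
    obtain ⟨t, ht, hts, hle⟩ := hno r hr hv
    obtain ⟨t', ht', hmax⟩ := S.exists_max_image (vd r) ⟨t, ht⟩
    by_cases h : t' = s₀
    · subst h
      exact ⟨t, ht, hts, fun u hu => (hmax u hu).trans hle⟩
    · exact ⟨t', ht', h, hmax⟩
  -- One representative minimizer for each possible closest point; `0` is a dummy where there is
  -- none.
  have hrep : ∀ t : R, ∃ r : R, (∃ x ∉ S, valAt S m x = d ∧ ∀ u ∈ S, vd x u ≤ vd x t) →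
      r ∉ S ∧ valAt S m r = d ∧ ∀ u ∈ S, vd r u ≤ vd r t := by
    intro t
    by_cases h : ∃ x ∉ S, valAt S m x = d ∧ ∀ u ∈ S, vd x u ≤ vd x t
    · exact ⟨h.choose, fun _ => h.choose_spec⟩
    · exact ⟨0, fun h' => absurd h' h⟩
  choose ρ hρ using hrep
  -- Every minimizer has a closest point other than `s₀`, so its row already occurs among the rows
  -- indexed by `t ≠ s₀`. The zero row at `s₀` makes `M` singular, and a kernel vector contradicts
  -- `IsExtremal.eq_zero`.
  let M : Matrix S S ℤ := Matrix.of fun t u => if (t : R) = s₀ then 0 else (vd (ρ t) u + 1 : ℤ)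
  obtain ⟨v, hv0, hv⟩ := Matrix.exists_mulVec_eq_zero_iff.2
    (Matrix.det_eq_zero_of_row_eq_zero (A := M) ⟨s₀, hs₀⟩ fun u => by simp [M])
  refine hv0 (funext fun s => ?_)
  have := hE.eq_zero hm hmin hmin' (fun s => if h : s ∈ S then v ⟨s, h⟩ else 0) ?_ s s.2
  · simpa using this
  · intro r hr hvr
    obtain ⟨t, ht, hts, hmax⟩ := hclose r hr hvr
    obtain ⟨h1, h2, h3⟩ := hρ t ⟨r, hr, hvr, hmax⟩
    have hrow := vd_eq_of_maximizer hm hr h1 ht (hvr.trans h2.symm) hmax h3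
    have hvt := congrFun hv ⟨t, ht⟩
    rw [Pi.zero_apply, Matrix.mulVec, dotProduct] at hvt
    rw [← hvt, ← Finset.sum_coe_sort S]
    refine Finset.sum_congr rfl fun u _ => ?_
    simp [M, hts, hrow u u.2]

/-- A minimizer `r` closest to `s` alone has the same valuations as `s` relative to the rest of `S`,
and `vd r s` is at least the isolation index; so row `s` attains the minimum. A point outside all
neighborhoods would fall strictly below the row of its closest point. -/
theorem IsExtremal.isBalanced_and_isWeight (hE : IsExtremal S m d) (hS : S.Nonempty)
    (hm : ∀ s ∈ S, 0 < m s) (hmin : ∀ r ∉ S, d ≤ valAt S m r)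
    (hmin' : ∃ r ∉ S, valAt S m r = d) : IsBalanced S ∧ IsWeight S m d := by
  have hrow : ∀ s ∈ S, rowVal S m s = d := by
    intro s hs
    obtain ⟨r, hr, hv, hlt⟩ := hE.exists_minimizer hm hmin hmin' hs
    have hst : ∀ t ∈ S, t ≠ s → vd s t = vd r t := fun t ht hts => by
      have := vd_eq_of_lt (r := t) (s := r) (t := s) (fun h => hr (h ▸ ht))
        (by rw [vd_comm]; exact hlt t ht hts)
      rw [vd_comm s t, this, vd_comm]
    have hiso : isolationIndex S s ≤ vd r s :=
      isolationIndex_le fun t ht hts => by rw [hst t ht hts]; exact hlt t ht hts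
    obtain ⟨x, hx, hxv⟩ := exists_valAt_eq_rowVal S s
    refine le_antisymm ?_ (hxv m ▸ hmin x hx)
    rw [← hv]
    refine Finset.sum_le_sum fun t ht => Nat.mul_le_mul_left _ ?_
    by_cases hts : t = s
    · rw [hts, isoMatrix_self]
      exact hiso
    · rw [isoMatrix_of_ne S (Ne.symm hts), hst t ht hts]
  refine ⟨Set.eq_univ_of_forall fun r => ?_, hm, hE.gcd_eq_one hS hm hmin hmin', hrow⟩
  rw [Set.mem_iUnion₂]
  by_cases hr : r ∈ S
  · exact ⟨r, hr, self_mem_nbhd _ _⟩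
  obtain ⟨s, hs, hmax⟩ := S.exists_max_image (vd r) hS
  refine ⟨s, hs, mem_nbhd_iff.2 (Or.inr ?_)⟩
  by_contra! hlt
  rw [vd_comm] at hlt
  refine (hmin r hr).not_gt ?_
  rw [← hrow s hs]
  refine Finset.sum_lt_sum (fun u hu => Nat.mul_le_mul_left _ ?_)
    ⟨s, hs, Nat.mul_lt_mul_of_pos_left (by rwa [isoMatrix_self]) (hm s hs)⟩
  by_cases hus : s = u
  · rw [← hus, isoMatrix_self]
    exact hlt.le
  · rw [isoMatrix_of_ne S hus, vd_eq_min (s := s) (t := u) (by rintro rfl; exact hr hu) hus (hmax u hu)]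
    exact min_le_right _ _

end Combinatorics

/-! ### Factorization of image-primitive polynomials -/

section ImagePrimitiveFactorization

variable {R K : Type*} [CommRing R] [IsLocalRing R] [Field K] [Algebra R K]

theorem IsImagePrimitive.isUnit {F : intValued R K} (hF : IsImagePrimitive F)
    (h : (F : K[X]).natDegree = 0) : IsUnit F := by
  obtain ⟨a, u, hu⟩ := (isImagePrimitive_iff F).1 hF
  refine associated_one_iff_isUnit.1 (associated_of_coe_eq (F := 1) u ?_).symm
  rw [eq_C_of_natDegree_eq_zero h, eval_C] at hu
  rw [eq_C_of_natDegree_eq_zero h, hu, OneMemClass.coe_one, mul_one]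

theorem IsImagePrimitive.pow {F : intValued R K} (hF : IsImagePrimitive F) (n : ℕ) :
    IsImagePrimitive (F ^ n) := by
  obtain ⟨a, u, hu⟩ := (isImagePrimitive_iff F).1 hF
  refine (isImagePrimitive_iff _).2 ⟨a, u ^ n, ?_⟩
  rw [SubmonoidClass.coe_pow, eval_pow, hu, Units.val_pow_eq_pow_val, map_pow]

variable [IsFractionRing R K]

theorem IsImagePrimitive.coe_ne_zero {F : intValued R K} (hF : IsImagePrimitive F) :
    (F : K[X]) ≠ 0 := by
  obtain ⟨a, u, hu⟩ := (isImagePrimitive_iff F).1 hF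
  intro h
  rw [h, eval_zero] at hu
  exact u.ne_zero (IsFractionRing.injective R K (by rw [← hu, map_zero]))

theorem IsImagePrimitive.of_mul_left {F G : intValued R K} (h : IsImagePrimitive (F * G)) :
    IsImagePrimitive F := by
  obtain ⟨a, u, hu⟩ := (isImagePrimitive_iff _).1 h
  obtain ⟨x, hx⟩ := F.2 a
  obtain ⟨y, hy⟩ := G.2 a
  rw [MulMemClass.coe_mul, eval_mul, ← hx, ← hy, ← map_mul] at hu
  have hxu : IsUnit x := isUnit_of_mul_isUnit_left
    (show IsUnit (x * y) from IsFractionRing.injective R K hu ▸ u.isUnit)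
  exact (isImagePrimitive_iff _).2 ⟨a, hxu.unit, hx.symm⟩

theorem IsImagePrimitive.of_mul_right {F G : intValued R K} (h : IsImagePrimitive (F * G)) :
    IsImagePrimitive G :=
  IsImagePrimitive.of_mul_left (mul_comm F G ▸ h)

/-- Image-primitive polynomials factor into irreducible elements. -/
theorem IsImagePrimitive.exists_factors {F : intValued R K} (hF : IsImagePrimitive F)
    (hu : ¬ IsUnit F) : ∃ l : Multiset (intValued R K), (∀ a ∈ l, Irreducible a) ∧ l.prod = F := by
  induction hn : (F : K[X]).natDegree using Nat.strong_induction_on generalizing F with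
  | _ n ih =>
  by_cases hirr : Irreducible F
  · exact ⟨{F}, by simpa using hirr, by simp⟩
  · rw [irreducible_iff, not_and_or, not_not, or_iff_right hu] at hirr
    push Not at hirr
    obtain ⟨A, B, rfl, hA, hB⟩ := hirr
    have hA' := hF.of_mul_left
    have hB' := hF.of_mul_right
    have hdA : (A : K[X]).natDegree ≠ 0 := fun h => hA (hA'.isUnit h)
    have hdB : (B : K[X]).natDegree ≠ 0 := fun h => hB (hB'.isUnit h)
    rw [MulMemClass.coe_mul, natDegree_mul hA'.coe_ne_zero hB'.coe_ne_zero] at hn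
    obtain ⟨l₁, h₁, rfl⟩ := ih _ (by omega) hA' hA rfl
    obtain ⟨l₂, h₂, rfl⟩ := ih _ (by omega) hB' hB rfl
    exact ⟨l₁ + l₂, fun a ha => (Multiset.mem_add.1 ha).elim (h₁ a) (h₂ a), Multiset.prod_add _ _⟩

/-- The divisors of the powers of an image-primitive absolutely irreducible polynomial. -/
theorem IsAbsolutelyIrreducible.exists_associated_pow {F G H : intValued R K}
    (hF : IsAbsolutelyIrreducible F) (hprim : IsImagePrimitive F) {N : ℕ} (hN : 1 ≤ N)
    (h : G * H = F ^ N) : ∃ k, Associated G (F ^ k) := by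
  have hGH : IsImagePrimitive (G * H) := h ▸ hprim.pow N
  by_cases hG : IsUnit G
  · exact ⟨0, by rw [pow_zero]; exact associated_one_iff_isUnit.2 hG⟩
  by_cases hH : IsUnit H
  · exact ⟨N, hH.unit, h⟩
  obtain ⟨l₁, h₁, rfl⟩ := hGH.of_mul_left.exists_factors hG
  obtain ⟨l₂, h₂, rfl⟩ := hGH.of_mul_right.exists_factors hH
  refine ⟨l₁.card, associated_prod_pow_card fun a ha => ?_⟩
  have := hF.2 N hN (l₁ + l₂) (Multiset.replicate N F)
    (fun a ha => (Multiset.mem_add.1 ha).elim (h₁ a) (h₂ a))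
    (fun a ha => Multiset.eq_of_mem_replicate ha ▸ hF.1) (by rw [Multiset.prod_add, h])
    (Multiset.prod_replicate _ _)
  exact (Multiset.rel_replicate_right.1 this).2 a (Multiset.mem_add.2 (Or.inl ha))

end ImagePrimitiveFactorization

/-! ### Absolute irreducibility, extremality and balanced sets -/

section Correspondence

variable {R K : Type*} [CommRing R] [IsDomain R] [IsDiscreteValuationRing R] [Field K] [Algebra R K]
  [IsFractionRing R K]

theorem exists_min_valAt (S : Finset R) (m : R → ℕ) :
    ∃ d, (∀ r ∉ S, d ≤ valAt S m r) ∧ ∃ r ∉ S, valAt S m r = d := by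
  obtain ⟨r, hr, -⟩ := exists_valAt_eq_rowVal S 0
  obtain ⟨x, hx, hmin⟩ := exists_minimalFor_of_wellFoundedLT (· ∉ S) (valAt S m) ⟨r, hr⟩
  refine ⟨_, fun y hy => ?_, x, hx, rfl⟩
  exact (le_total _ _).elim id fun h => hmin hy h

/-- An absolutely irreducible polynomial of positive degree is image-primitive, so that the
valuation of its leading coefficient cancels the minimum of `valAt`. -/
theorem fracVal_eq_neg_of_irreducible {S : Finset R} (hS : S.Nonempty) {m : R → ℕ}
    (hm : ∀ s ∈ S, 0 < m s) {c : K} (hc : c ≠ 0) {F : intValued R K}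
    (hF : (F : K[X]) = splitPoly S m c) (hirr : Irreducible F) {d : ℕ}
    (hmin : ∀ r ∉ S, d ≤ valAt S m r) (hmin' : ∃ r ∉ S, valAt S m r = d) :
    fracVal R c = -d := by
  obtain ⟨r₀, hr₀, hv₀⟩ := hmin'
  have hge : 0 ≤ fracVal R c + d := by
    rw [← hv₀]
    exact (splitPoly_mem_intValued_iff hc).1 (hF ▸ F.2) r₀ hr₀
  by_contra hne
  have hπ := algebraMap_unif_ne_zero R K
  have hc' : c / algebraMap R K (unif R) ≠ 0 := div_ne_zero hc hπ
  have hval : fracVal R c = fracVal R (c / algebraMap R K (unif R)) + 1 := by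
    have h1 : fracVal R (algebraMap R K (unif R)) = 1 := by
      simpa using fracVal_zpow (R := R) (K := K) 1
    rw [← h1, ← fracVal_mul hc' hπ, div_mul_cancel₀ _ hπ]
  -- If `v(c) + d` were positive, `F` divided by the uniformizer would still be integer-valued,
  -- giving a proper factorization of `F`.
  let G : intValued R K := ⟨splitPoly S m (c / algebraMap R K (unif R)), by
    rw [splitPoly_mem_intValued_iff hc']
    intro r hr
    have := hmin r hr
    omega⟩
  have hFG : F = algebraMap R (intValued R K) (unif R) * G := Subtype.ext (by
    rw [hF]
    change _ = C (algebraMap R K (unif R)) * splitPoly S m _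
    rw [C_mul_splitPoly, mul_div_cancel₀ _ hπ])
  rcases hirr.isUnit_or_isUnit hFG with h | h
  · obtain ⟨H, hH⟩ := h.exists_right_inv
    have := congrArg (fun P : intValued R K => (P : K[X]).eval (algebraMap R K 0)) hH
    change (C (algebraMap R K (unif R)) * (H : K[X])).eval (algebraMap R K 0) =
      (1 : K[X]).eval (algebraMap R K 0) at this
    obtain ⟨y, hy⟩ := H.2 0
    rw [eval_mul, eval_C, eval_one, ← hy, ← map_mul, ← map_one (algebraMap R K)] at this
    exact (irreducible_unif R).not_isUnit
      (IsUnit.of_mul_eq_one _ (IsFractionRing.injective R K this))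
  · have := natDegree_eq_zero_of_isUnit h
    rw [splitPoly_natDegree S m hc'] at this
    exact (Finset.sum_pos hm hS).ne' this

/-- A decomposition with lower bounds `p` and `q` lifts to a factorization of `F ^ N` whose factors
have leading coefficients of valuation `-p` and `-q`. The first factor is then associated to a power
of `F`, which gives its exponents. -/
theorem isExtremal_of_isAbsolutelyIrreducible {S : Finset R} {m : R → ℕ}
    (hm : ∀ s ∈ S, 0 < m s) {c : K} (hc : c ≠ 0) {F : intValued R K}
    (hF : (F : K[X]) = splitPoly S m c) (habs : IsAbsolutelyIrreducible F) {d : ℕ}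
    (hcd : fracVal R c = -d) (hmin' : ∃ r ∉ S, valAt S m r = d) :
    IsExtremal S m d := by
  intro N g h p q hN hgh hpq hp hq
  have hπ := algebraMap_unif_ne_zero R K
  have hprim : IsImagePrimitive F := by
    obtain ⟨r, hr, hv⟩ := hmin'
    exact (isImagePrimitive_splitPoly_iff hm hc hF).2 ⟨r, hr, by rw [hcd, hv]; ring⟩
  have hg0 : algebraMap R K (unif R) ^ (-p) ≠ 0 := zpow_ne_zero _ hπ
  have hh0 : c ^ N * algebraMap R K (unif R) ^ p ≠ 0 :=
    mul_ne_zero (pow_ne_zero _ hc) (zpow_ne_zero _ hπ)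
  let G : intValued R K := ⟨splitPoly S g (algebraMap R K (unif R) ^ (-p)), by
    rw [splitPoly_mem_intValued_iff hg0]
    intro r hr
    have := hp r hr
    rw [fracVal_zpow]
    omega⟩
  let H : intValued R K := ⟨splitPoly S h (c ^ N * algebraMap R K (unif R) ^ p), by
    rw [splitPoly_mem_intValued_iff hh0]
    intro r hr
    have := hq r hr
    rw [fracVal_mul (pow_ne_zero _ hc) (zpow_ne_zero _ hπ), fracVal_pow hc, fracVal_zpow, hcd]
    linarith⟩
  have hGH : G * H = F ^ N := Subtype.ext (by
    rw [SubmonoidClass.coe_pow, hF, splitPoly_pow]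
    change splitPoly S g _ * splitPoly S h _ = _
    rw [splitPoly_mul, zpow_neg, mul_left_comm, inv_mul_cancel₀ (zpow_ne_zero _ hπ), mul_one]
    exact splitPoly_congr hgh _)
  obtain ⟨k, hk⟩ := habs.exists_associated_pow hprim hN hGH
  refine ⟨k, fun s hs => ?_⟩
  obtain ⟨U, hU⟩ := hk.map (intValued R K).val
  obtain ⟨x, hx, hxU⟩ := Polynomial.isUnit_iff.1 U.isUnit
  have : splitPoly S g (x * algebraMap R K (unif R) ^ (-p)) = splitPoly S (k • m) (c ^ k) := by
    rw [← splitPoly_pow, ← hF, ← C_mul_splitPoly, hxU, mul_comm]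
    exact hU
  exact splitPoly_inj (mul_ne_zero hx.ne_zero hg0) (pow_ne_zero _ hc) this s hs

theorem IsAbsolutelyIrreducible.isBalanced {S : Finset R} (hS : S.Nonempty) {m : R → ℕ}
    (hm : ∀ s ∈ S, 0 < m s) {c : K} (hc : c ≠ 0) {F : intValued R K}
    (hF : (F : K[X]) = splitPoly S m c) (habs : IsAbsolutelyIrreducible F) :
    IsBalanced S ∧ ∃ e : ℕ, IsWeight S m e ∧ fracVal R c = -e := by
  obtain ⟨d, hmin, hmin'⟩ := exists_min_valAt S m
  have hcd := fracVal_eq_neg_of_irreducible hS hm hc hF habs.1 hmin hmin'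
  have hE := isExtremal_of_isAbsolutelyIrreducible hm hc hF habs hcd hmin'
  obtain ⟨hb, hw⟩ := hE.isBalanced_and_isWeight hS hm hmin hmin'
  exact ⟨hb, d, hw, hcd⟩

theorem IsBalanced.splitPoly_mem_intValued {S : Finset R} (hS : IsBalanced S) {m : R → ℕ} {e : ℕ}
    (hm : IsWeight S m e) {c : K} (hc : c ≠ 0) (hce : 0 ≤ fracVal R c + e) :
    splitPoly S m c ∈ intValued R K := by
  rw [splitPoly_mem_intValued_iff hc]
  intro r hr
  obtain ⟨s, hs, hle⟩ := hS.exists_rowVal_le hr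
  have := hle m
  rw [hm.rowVal_eq s hs] at this
  omega

/-- For balanced `S` the minimum of `valAt` is the common row value `e`, and image-primitivity means
that `v(c)` cancels it. -/
theorem IsBalanced.isImagePrimitive_iff_fracVal {S : Finset R} (hS : IsBalanced S) {m : R → ℕ}
    {e : ℕ} (hm : IsWeight S m e) {c : K} (hc : c ≠ 0) {F : intValued R K}
    (hF : (F : K[X]) = splitPoly S m c) : IsImagePrimitive F ↔ fracVal R c = -e := by
  rw [isImagePrimitive_splitPoly_iff hm.pos hc hF]
  obtain ⟨s₀, hs₀⟩ := hS.nonempty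
  have h0 := fracVal_add_rowVal_nonneg hc (hF ▸ F.2) s₀
  rw [hm.rowVal_eq s₀ hs₀] at h0
  constructor
  · rintro ⟨r, hr, hv⟩
    obtain ⟨s, hs, hle⟩ := hS.exists_rowVal_le hr
    have := hle m
    rw [hm.rowVal_eq s hs] at this
    omega
  · intro h
    obtain ⟨r, hr, hv⟩ := exists_valAt_eq_rowVal S s₀
    refine ⟨r, hr, ?_⟩
    rw [hv, hm.rowVal_eq s₀ hs₀, h]
    ring

end Correspondence

/-! ### Ingredients of the bijection -/

section Bijection

variable {R K : Type*} [CommRing R] [IsDomain R] [IsDiscreteValuationRing R] [Field K] [Algebra R K]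
  [IsFractionRing R K]

theorem IsBalanced.existsUnique_isEqualizingPolynomial {S : Finset R} (hS : IsBalanced S) :
    ∃! f : intValued R K, IsEqualizingPolynomial S f := by
  obtain ⟨m, e, hm⟩ := exists_isWeight hS.nonempty
  refine ⟨⟨splitPoly S m 1, hS.splitPoly_mem_intValued hm one_ne_zero
    (by rw [fracVal_one]; positivity)⟩, hS.isEqualizingPolynomial_iff.2 ⟨m, e, hm, rfl⟩, ?_⟩
  intro f hf
  obtain ⟨n, a, hn, hfn⟩ := hS.isEqualizingPolynomial_iff.1 hf
  exact Subtype.ext (hfn.trans (splitPoly_congr (hm.unique hn) 1))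

theorem exists_isBalanced_of_mem_splitAbsIrred (F : splitAbsIrred R K) :
    ∃ S : Finset R, IsBalanced S ∧ ∃ (m : R → ℕ) (e : ℕ) (c : K), IsWeight S m e ∧ c ≠ 0 ∧
      fracVal R c = -e ∧ ((F : intValued R K) : K[X]) = splitPoly S m c := by
  obtain ⟨F, habs, S, hS, m, hm, c, hc, hF⟩ := F
  obtain ⟨hb, e, hw, he⟩ := habs.isBalanced hS hm (inv_ne_zero hc) hF
  exact ⟨S, hb, m, e, c⁻¹, hw, inv_ne_zero hc, he, hF⟩

theorem IsWeight.mem_splitAbsIrred {S : Finset R} {m : R → ℕ} {e : ℕ} (hm : IsWeight S m e)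
    (hS : S.Nonempty) {c : K} (hc : c ≠ 0) (hce : fracVal R c = -e) {F : intValued R K}
    (hF : (F : K[X]) = splitPoly S m c) : F ∈ splitAbsIrred R K :=
  ⟨hm.isAbsolutelyIrreducible hc hce hF, S, hS, m, hm.pos, c⁻¹, inv_ne_zero hc, by
    rw [inv_inv, hF, splitPoly]⟩

theorem IsBalanced.exists_mem_splitAbsIrred {S : Finset R} (hS : IsBalanced S) {m : R → ℕ} {e : ℕ}
    (hm : IsWeight S m e) : ∃ (F : splitAbsIrred R K) (c : K), c ≠ 0 ∧
      ((F : intValued R K) : K[X]) = splitPoly S m c := by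
  have hc : algebraMap R K (unif R) ^ (-e : ℤ) ≠ 0 := zpow_ne_zero _ (algebraMap_unif_ne_zero R K)
  have hce := fracVal_zpow (R := R) (K := K) (-e)
  have hmem := hS.splitPoly_mem_intValued hm hc (by rw [hce, neg_add_cancel])
  exact ⟨⟨⟨_, hmem⟩, hm.mem_splitAbsIrred hS.nonempty hc hce rfl⟩, _, hc, rfl⟩

theorem IsWeight.exists_eq_unit_mul {S : Finset R} {m n : R → ℕ} {e a : ℕ} (hm : IsWeight S m e)
    (hn : IsWeight S n a) (hS : S.Nonempty) {c d : K} (hc : c ≠ 0) (hd : d ≠ 0)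
    (hce : fracVal R c = -e) (hda : fracVal R d = -a) {F G : K[X]} (hF : F = splitPoly S m c)
    (hG : G = splitPoly S n d) : ∃ u : Rˣ, G = C (algebraMap R K u) * F := by
  have hnm := hm.unique hn
  have hea : e = a := by
    obtain ⟨s, hs⟩ := hS
    rw [← hm.rowVal_eq s hs, ← hn.rowVal_eq s hs]
    exact Finset.sum_congr rfl fun t ht => by rw [hnm t ht]
  obtain ⟨u, hu⟩ := exists_unit_mul_of_fracVal_eq hc hd (by rw [hce, hda, hea])
  exact ⟨u, by rw [hF, hG, C_mul_splitPoly, ← hu, splitPoly_congr hnm]⟩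

/-- `f` is `unif R ^ e` times an image-primitive polynomial. -/
theorem IsBalanced.fixedDivisor_eq {S : Finset R} (hS : IsBalanced S) {m : R → ℕ} {e : ℕ}
    (hm : IsWeight S m e) {f : intValued R K} (hf : (f : K[X]) = splitPoly S m 1) :
    fixedDivisor f = Ideal.span {unif R ^ e} := by
  have hπ := algebraMap_unif_ne_zero R K
  have hc : algebraMap R K (unif R) ^ (-e : ℤ) ≠ 0 := zpow_ne_zero _ hπ
  have hce := fracVal_zpow (R := R) (K := K) (-e)
  have hmem := hS.splitPoly_mem_intValued hm hc (by rw [hce, neg_add_cancel])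
  have hfF : ∀ x : K, (f : K[X]).eval x = algebraMap R K (unif R ^ e) *
      (splitPoly S m (algebraMap R K (unif R) ^ (-e : ℤ))).eval x := by
    intro x
    rw [hf, splitPoly_eval, splitPoly_eval, ← mul_assoc, map_pow, ← zpow_natCast, ← zpow_add₀ hπ,
      add_neg_cancel, zpow_zero]
  refine le_antisymm (Ideal.span_le.2 ?_) ((Ideal.span_singleton_le_iff_mem _).2 ?_)
  · rintro b ⟨a, hb⟩
    obtain ⟨y, hy⟩ := hmem a
    rw [hfF, ← hy, ← map_mul] at hb
    exact Ideal.mem_span_singleton.2 ⟨y, IsFractionRing.injective R K hb⟩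
  · obtain ⟨a, u, hu⟩ := (isImagePrimitive_iff ⟨_, hmem⟩).1
      ((hS.isImagePrimitive_iff_fracVal hm hc rfl).2 hce)
    refine (Ideal.mul_unit_mem_iff_mem _ u.isUnit).1 (Ideal.subset_span ⟨a, ?_⟩)
    rw [hfF, map_mul, ← hu]

theorem fracVal_of_span_eq {d : R} {e : ℕ} (h : Ideal.span {d} = Ideal.span {unif R ^ e}) :
    algebraMap R K d ≠ 0 ∧ fracVal R (algebraMap R K d) = e := by
  obtain ⟨u, hu⟩ := (Ideal.span_singleton_eq_span_singleton.1 h).symm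
  have : algebraMap R K d = algebraMap R K u * algebraMap R K (unif R) ^ (e : ℤ) := by
    rw [← hu, map_mul, map_pow, zpow_natCast, mul_comm]
  rw [this]
  exact ⟨mul_ne_zero (algebraMap_unit_ne_zero u) (zpow_ne_zero _ (algebraMap_unif_ne_zero R K)),
    fracVal_unit_mul_zpow u e⟩

end Bijection
end IntPoly

/-! ### The correspondence between polynomials and balanced sets -/

theorem corollary3 {R K : Type*} [CommRing R] [IsDomain R] [IsDiscreteValuationRing R]
    [Finite (IsLocalRing.ResidueField R)] [Field K] [Algebra R K] [IsFractionRing R K] :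
    (∀ S : {S : Finset R // IntPoly.IsBalanced S},
      ∃! f : IntPoly.intValued R K, IntPoly.IsEqualizingPolynomial S.1 f) ∧
    ∃ Φ : Quotient (IntPoly.unitSetoid R K) ≃ {S : Finset R // IntPoly.IsBalanced S},
      (∀ F : IntPoly.splitAbsIrred R K,
        {x : K | (((F : IntPoly.intValued R K) : K[X])).IsRoot x} =
          algebraMap R K '' ((Φ (Quotient.mk (IntPoly.unitSetoid R K) F)).1 : Set R)) ∧
      (∀ (S : {S : Finset R // IntPoly.IsBalanced S}) (f : IntPoly.intValued R K),
        IntPoly.IsEqualizingPolynomial S.1 f →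
          (∃ d : R, IntPoly.fixedDivisor f = Ideal.span {d}) ∧
          (∀ d : R, IntPoly.fixedDivisor f = Ideal.span {d} →
            ∃ F : IntPoly.splitAbsIrred R K,
              ((F : IntPoly.intValued R K) : K[X]) = C (algebraMap R K d)⁻¹ * (f : K[X]) ∧
              IntPoly.IsImagePrimitive (F : IntPoly.intValued R K) ∧
              Φ.symm S = Quotient.mk (IntPoly.unitSetoid R K) F) ∧
          (∀ G : IntPoly.intValued R K, IntPoly.IsImagePrimitive G →
            Associated (G : K[X]) (f : K[X]) →
              ∃ hG : G ∈ IntPoly.splitAbsIrred R K,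
                Φ.symm S = Quotient.mk (IntPoly.unitSetoid R K) ⟨G, hG⟩)) := by
  refine ⟨fun S => S.2.existsUnique_isEqualizingPolynomial, ?_⟩
  choose T hT using IntPoly.exists_isBalanced_of_mem_splitAbsIrred (R := R) (K := K)
  have hroots : ∀ F : IntPoly.splitAbsIrred R K,
      {x : K | ((F : IntPoly.intValued R K) : K[X]).IsRoot x} = algebraMap R K '' T F := by
    intro F
    obtain ⟨_, m, e, c, hm, hc, -, hF⟩ := hT F
    rw [hF, IntPoly.splitPoly_rootSet hm.pos hc]
  -- As `R` embeds in `K`, the root set in `K` determines the balanced set; this identifies the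
  -- chosen `T F` in all that follows.
  have hTeq : ∀ (F : IntPoly.splitAbsIrred R K) (S : Finset R),
      {x : K | ((F : IntPoly.intValued R K) : K[X]).IsRoot x} = algebraMap R K '' S → T F = S := by
    intro F S h
    rw [hroots] at h
    exact Finset.coe_injective ((IsFractionRing.injective R K).image_injective h)
  let Ψ : Quotient (IntPoly.unitSetoid R K) → {S : Finset R // IntPoly.IsBalanced S} :=
    Quotient.lift (fun F => ⟨T F, (hT F).1⟩) (by
      rintro F G ⟨u, hu⟩
      refine Subtype.ext (hTeq F _ ?_)
      rw [← hroots, hu]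
      ext x
      simp)
  have hbij : Function.Bijective Ψ := by
    constructor
    · intro F G
      induction F using Quotient.inductionOn with | _ F
      induction G using Quotient.inductionOn with | _ G
      intro h
      have h : T F = T G := congrArg Subtype.val h
      obtain ⟨_, m, e, c, hm, hc, hce, hF⟩ := hT F
      obtain ⟨_, n, a, d, hn, hd, hda, hG⟩ := hT G
      rw [← h] at hn hG
      exact Quotient.sound (hm.exists_eq_unit_mul hn (hT F).1.nonempty hc hd hce hda hF hG)
    · intro S
      obtain ⟨m, e, hm⟩ := IntPoly.exists_isWeight S.2.nonempty
      obtain ⟨F, c, hc, hF⟩ := S.2.exists_mem_splitAbsIrred (K := K) hm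
      refine ⟨Quotient.mk _ F, Subtype.ext (hTeq F _ ?_)⟩
      rw [hF, IntPoly.splitPoly_rootSet hm.pos hc]
  have hsymm : ∀ (S : {S : Finset R // IntPoly.IsBalanced S}) (F : IntPoly.splitAbsIrred R K),
      {x : K | ((F : IntPoly.intValued R K) : K[X]).IsRoot x} = algebraMap R K '' S.1 →
        (Equiv.ofBijective Ψ hbij).symm S = Quotient.mk (IntPoly.unitSetoid R K) F := by
    intro S F h
    rw [Equiv.symm_apply_eq]
    exact Subtype.ext (hTeq F _ h).symm
  refine ⟨Equiv.ofBijective Ψ hbij, hroots, fun S f hf => ?_⟩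
  obtain ⟨m, e, hm, hfm⟩ := S.2.isEqualizingPolynomial_iff.1 hf
  have hfd := S.2.fixedDivisor_eq hm hfm
  refine ⟨⟨_, hfd⟩, fun d hd => ?_, fun G hG hass => ?_⟩
  · obtain ⟨hd0, hdv⟩ := IntPoly.fracVal_of_span_eq (K := K) (hd.symm.trans hfd)
    have hc : (algebraMap R K d)⁻¹ ≠ 0 := inv_ne_zero hd0
    have hce : IntPoly.fracVal R (algebraMap R K d)⁻¹ = -e := by
      have := IntPoly.fracVal_mul (R := R) hc hd0
      rw [inv_mul_cancel₀ hd0, IntPoly.fracVal_one, hdv] at this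
      linarith
    have hF : C (algebraMap R K d)⁻¹ * (f : K[X]) =
        IntPoly.splitPoly S.1 m (algebraMap R K d)⁻¹ := by
      rw [hfm, IntPoly.C_mul_splitPoly, mul_one]
    have hmem := S.2.splitPoly_mem_intValued hm hc (by rw [hce, neg_add_cancel])
    refine ⟨⟨⟨_, hmem⟩, hm.mem_splitAbsIrred S.2.nonempty hc hce rfl⟩, hF.symm,
      (S.2.isImagePrimitive_iff_fracVal hm hc rfl).2 hce, hsymm S _ ?_⟩
    exact IntPoly.splitPoly_rootSet hm.pos hc
  -- Associates in `K[X]` differ by a nonzero constant `x`, and image-primitivity forces `v(x) =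
  -- -e`.
  · obtain ⟨U, hU⟩ := hass.symm
    obtain ⟨x, hx, hxU⟩ := Polynomial.isUnit_iff.1 U.isUnit
    have hGx : (G : K[X]) = IntPoly.splitPoly S.1 m x := by
      rw [← hU, hfm, ← hxU, mul_comm, IntPoly.C_mul_splitPoly, mul_one]
    have hxe := (S.2.isImagePrimitive_iff_fracVal hm hx.ne_zero hGx).1 hG
    refine ⟨hm.mem_splitAbsIrred S.2.nonempty hx.ne_zero hxe hGx, hsymm S _ ?_⟩
    change {y : K | (G : K[X]).IsRoot y} = _
    rw [hGx, IntPoly.splitPoly_rootSet hm.pos hx.ne_zero]
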